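/- Let $\alpha\in(0,1)$. **Trees.** An $\mathbb R$-tree is a metric space $(T,d)$ in which any two points $z,w$ are joined by a unique isometric image $[\![z,w]\!]$ of $[0,d(z,w)]$, and every arc from $z$ to $w$ has range $[\![z,w]\!]$. A spatial tree is a quadruple $\zeta=(T,*,d,M)$ with $(T,d)$ a complete locally compact $\mathbb R$-tree, $*\in T$, and $M=(M_t,M_x):T\to\mathbb R^2$ proper, continuous and locally little $\alpha$-Hölder, i.e. $\lim_{\varepsilon\to0}\sup_{z\in A}\sup_{0<d(z,w)\le\varepsilon}\|M(z)-M(w)\|/d(z,w)^\alpha=0$ for all compact $A$; trees are identified under bijective isometries respecting $*$ and $M$. For $z_0,z_1\in T$ and $s\in[0,1]$ write $z_s$ for the point of $[\![z_0,z_1]\!]$ at distance $s\,d(z_0,z_1)$ from $z_0$. The tree is *characteristic*, $\zeta\in\mathbb C^\alpha_{\rm sp}$, if 1. $M_t(z_s)=(M_t(z_0)-s\,d(z_0,z_1))\vee(M_t(z_1)-(1-s)d(z_0,z_1))$ for all $z_0,z_1,s$; 2. whenever $s<t$, $a<b$, $M_t(z_0)=M_t(\bar z_0)=t$, $M_t(z_1)=M_t(\bar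 z_1)=s$, $M_x(z_0)<M_x(\bar z_0)$ and $M$ maps $[\![z_0,z_1]\!]$ and $[\![\bar z_0,\bar z_1]\!]$ into $[s,t]\times(a,b)$, then $M_x(z_r)\le M_x(\bar z_r)$ for all $r\in[0,1]$; 3. $M^{-1}(\{t\}\times[x-1,x+1])\ne\emptyset$ for all $(t,x)\in\mathbb R^2$. **Distance of trees.** Let $b_\zeta(r)=\sup\{d(*,z):M(z)\in[-r,r]^2\}$ for $r\ge0$ (with $\sup\emptyset=0$) and $b_\zeta(r)=0$ for $r<0$. For $r>0$ let $$\mathbf\Delta_r(\zeta,\zeta')=\inf_C\Big\{\tfrac12\operatorname{dis}C+\sup_{(z,z')\in C}\|M(z)-M'(z')\|+\sup_{n\ge1}2^{n\alpha}\sup\|(M(z)-M(w))-(M'(z')-M'(w'))\|\Big\},$$ where $C$ runs over the correspondences, containing $(*,*')$, between the closed $r$-balls around $*$ and $*'$, where $\operatorname{dis}C=\sup\{|d(z,w)-d'(z',w')|:(z,z'),(w,w')\in C\}$, and where the last supremum is over $(z,z'),(w,w')\in C$ with $d(z,w),d'(z',w')\in(2^{-n},2^{-(n-1)}]$; if no pair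 in one of the two trees is at such a distance, then the increment in that tree is omitted and the supremum is over the pairs at such a distance in the other one. The space $\mathbb C^\alpha_{\rm sp}$ has the topology of $$\Delta_{\rm sp}(\zeta,\zeta')=\int_0^\infty e^{-r}\big[1\wedge\mathbf\Delta_r(\zeta,\zeta')\big]\,dr+d_{\rm M1}(b_\zeta,b_{\zeta'}),\qquad d_{\rm M1}(f,g)=\int_0^\infty e^{-t}\Big[1\wedge\inf_{\gamma_f,\gamma_g}\|\gamma_f-\gamma_g\|_\infty\Big]dt,$$ the infimum being over the parametric representations of $f$ and $g$ on $[-1,t]$, i.e. the continuous non-decreasing maps from $[-1,t]$ onto their completed graphs. **Paths.** A backward path $\pi$ with starting time $\sigma_\pi\in[-\infty,\infty]$ is a continuous map $\pi:\mathbb R\to[-\infty,\infty]$ that is constant on $[\sigma_\pi,\infty)$; all paths with $\sigma_\pi=-\infty$ are identified. Let $\Pi$ be the space of these paths with the metric $$d(\pi_1,\pi_2)=|\tanh\sigma_{\pi_1}-\tanh\sigma_{\pi_2}|\vee\sup_{t\in\mathbb R}\Big|\frac{\tanh\pi_1(t\wedge\sigma_{\pi_1})}{1+|t\wedge\sigma_{\pi_1}|}-\frac{\tanh\pi_2(t\wedge\sigma_{\pi_2})}{1+|t\wedge\sigma_{\pi_2}|}\Big|$$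 (a fraction is $0$ if the time in it is $-\infty$), which induces the topology of Fontes, Isopi, Newman and Ravishankar: convergence of starting times and locally uniform convergence of paths. Let $\mathcal H$ be the space of nonempty compact subsets of $\Pi$ with the Hausdorff metric. **The map $K$.** Every characteristic tree has a unique open end $\dagger$ (with unbounded rays) such that $M_t(w)=M_t(z)-d(z,w)$ for all $z\in T$ and all $w$ on the ray $[\![z,\dagger\rangle$. Let $\rho(z,s)$, $s\le M_t(z)$, be the point of $[\![z,\dagger\rangle$ at distance $M_t(z)-s$ from $z$, let $\pi_z\in\Pi$ be the path $\pi_z(s)=M_x(\rho(z,s))$ with starting time $M_t(z)$, and let $K(\zeta)$ be the closure of $\{\pi_z:z\in T\}$ in $\Pi$. **Proposition.** For every $\zeta\in\mathbb C^\alpha_{\rm sp}$ the set $K(\zeta)$ is a (nonempty) compact subset of $\Pi$, and the map $\zeta\mapsto K(\zeta)$ is continuous from $\mathbb C^\alpha_{\rm sp}$ to $\mathcal H$. In other words, the topology of $\Delta_{\rm sp}$ on $\mathbb C^\alpha_{\rm sp}$ is finer than the topology induced on it by $\mathcal H$ through $K$. -/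

import Mathlib

open Set Topology
open scoped ENNReal NNReal

noncomputable section

/-! ### Real trees -/

section RealTree

variable {T : Type} [MetricSpace T]

/-- `f : [0, d(z, w)] → T` is an isometric map with `f 0 = z` and `f (d(z, w)) = w`. -/
def IsGeodesicMap (z w : T) (f : Icc (0 : ℝ) (dist z w) → T) : Prop :=
  Isometry f ∧ f ⟨0, le_refl 0, dist_nonneg⟩ = z ∧ f ⟨dist z w, dist_nonneg, le_refl _⟩ = w

/-- The segment `⟦z, w⟧`: the range of the isometric map joining `z` to `w`. -/
def geodesicSegment (z w : T) : Set T :=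
  {v | ∃ f : Icc (0 : ℝ) (dist z w) → T, IsGeodesicMap z w f ∧ v ∈ range f}

variable (T) in
/-- `T` is an `ℝ`-tree: unique geodesics, and every arc between two points has the same
range as the geodesic between them. -/
structure IsRealTree : Prop where
  existsUnique_geodesic : ∀ z w : T, ∃! f : Icc (0 : ℝ) (dist z w) → T, IsGeodesicMap z w f
  range_arc : ∀ (z w : T) (f : Icc (0 : ℝ) (dist z w) → T) (q : Icc (0 : ℝ) 1 → T),
    IsGeodesicMap z w f → Continuous q → Function.Injective q → q 0 = z → q 1 = w →
      range q = range f

variable (T) in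
/-- An open end `†` of `T` with unbounded rays, given by its rays `⟦z, †⟩`: `ray z u` is the
point of `⟦z, †⟩` at distance `u` from `z`, that is `ι_z⁻¹(u)`. Rays that represent the same
end coincide from some point on. -/
structure UnboundedEnd where
  ray : T → ℝ≥0 → T
  isometry_ray : ∀ z, Isometry (ray z)
  ray_zero : ∀ z, ray z 0 = z
  equiv : ∀ z w, ∃ a b : ℝ≥0, ∀ u : ℝ≥0, ray z (a + u) = ray w (b + u)

end RealTree

/-! ### Spatial trees and characteristic trees -/

/-- A (representative of a) pointed `α`-spatial `ℝ`-tree `(T, ∗, d, M)`. The plane carries the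
Euclidean norm; coordinate `0` is time and coordinate `1` is space. Such a `T` is separable, so
up to isometry nothing is lost by taking it in `Type`. -/
structure SpatialTree (α : ℝ) where
  carrier : Type
  [metric : MetricSpace carrier]
  base : carrier
  eval : carrier → EuclideanSpace ℝ (Fin 2)
  isRealTree : IsRealTree carrier
  complete : CompleteSpace carrier
  locallyCompact : LocallyCompactSpace carrier
  proper : IsProperMap eval
  littleHolder : ∀ A : Set carrier, IsCompact A → ∀ η : ℝ, 0 < η → ∃ ε : ℝ, 0 < ε ∧
    ∀ z ∈ A, ∀ w : carrier, dist z w ≤ ε → ‖eval z - eval w‖ ≤ η * dist z w ^ α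

attribute [instance] SpatialTree.metric

namespace SpatialTree

variable {α : ℝ}

/-- The time component `M_t` of the evaluation map. -/
def time (ζ : SpatialTree α) (z : ζ.carrier) : ℝ := ζ.eval z 0

/-- The space component `M_x` of the evaluation map. -/
def space (ζ : SpatialTree α) (z : ζ.carrier) : ℝ := ζ.eval z 1

/-- A bijective isometry preserving base points and evaluation maps. -/
def Isomorphic (ζ ζ' : SpatialTree α) : Prop :=
  ∃ φ : ζ.carrier ≃ᵢ ζ'.carrier, φ ζ.base = ζ'.base ∧ ∀ z, ζ'.eval (φ z) = ζ.eval z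

/-- The point of `⟦z₀, z₁⟧` at distance `s * d(z₀, z₁)` from `z₀`. -/
def IsPointAt (ζ : SpatialTree α) (z₀ z₁ : ζ.carrier) (s : ℝ) (w : ζ.carrier) : Prop :=
  w ∈ geodesicSegment z₀ z₁ ∧ dist z₀ w = s * dist z₀ z₁

/-- Monotonicity in time, monotonicity in space, and spread. -/
structure IsCharacteristic (ζ : SpatialTree α) : Prop where
  monotone_time : ∀ (z₀ z₁ w : ζ.carrier) (s : ℝ), s ∈ Icc (0 : ℝ) 1 → ζ.IsPointAt z₀ z₁ s w →
    ζ.time w = max (ζ.time z₀ - s * dist z₀ z₁) (ζ.time z₁ - (1 - s) * dist z₀ z₁)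
  monotone_space : ∀ (s t a b : ℝ) (z₀ z₀' z₁ z₁' : ζ.carrier), s < t →
    ζ.time z₀ = t → ζ.time z₀' = t → ζ.time z₁ = s → ζ.time z₁' = s →
    ζ.space z₀ < ζ.space z₀' →
    (∀ w ∈ geodesicSegment z₀ z₁, ζ.time w ∈ Icc s t ∧ ζ.space w ∈ Ioo a b) →
    (∀ w ∈ geodesicSegment z₀' z₁', ζ.time w ∈ Icc s t ∧ ζ.space w ∈ Ioo a b) →
    ∀ r ∈ Icc (0 : ℝ) 1, ∀ w w' : ζ.carrier,
      ζ.IsPointAt z₀ z₁ r w → ζ.IsPointAt z₀' z₁' r w' → ζ.space w ≤ ζ.space w'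
  spread : ∀ t x : ℝ, ∃ z : ζ.carrier, ζ.time z = t ∧ ζ.space z ∈ Icc (x - 1) (x + 1)

/-- The properness map `b_ζ(r) = sup {d(∗, z) : M(z) ∈ [-r, r]²}`, with `b_ζ(r) = 0` for `r < 0`
(and `sup ∅ = 0`). -/
def properness (ζ : SpatialTree α) (r : ℝ) : ℝ :=
  if r < 0 then 0
  else sSup {x | ∃ z : ζ.carrier, |ζ.time z| ≤ r ∧ |ζ.space z| ≤ r ∧ x = dist ζ.base z}

end SpatialTree

/-! ### The `M1` distance between càdlàg functions on `[-1, ∞)` -/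

/-- The completed graph of `f` over `[-1, t]`, as a set of points (time, value). It is used for
functions that vanish on `(-∞, 0)`, so there is no jump at `-1`. -/
def completedGraph (f : ℝ → ℝ) (t : ℝ) : Set (ℝ × ℝ) :=
  {p | p.1 ∈ Icc (-1) t ∧ p.2 ∈ uIcc (Function.leftLim f p.1) (f p.1)}

/-- The order on the completed graph. -/
def completedGraphLE (f : ℝ → ℝ) (p q : ℝ × ℝ) : Prop :=
  p.1 < q.1 ∨ (p.1 = q.1 ∧ |Function.leftLim f p.1 - p.2| ≤ |Function.leftLim f p.1 - q.2|)

/-- Parametric representations: continuous non-decreasing maps from `[-1, t]` onto the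
completed graph. -/
def IsParametricRep (f : ℝ → ℝ) (t : ℝ) (γ : ℝ → ℝ × ℝ) : Prop :=
  ContinuousOn γ (Icc (-1) t) ∧ γ '' Icc (-1) t = completedGraph f t ∧
    ∀ u ∈ Icc (-1) t, ∀ v ∈ Icc (-1) t, u ≤ v → completedGraphLE f (γ u) (γ v)

/-- The `M1` distance of the restrictions to `[-1, t]`: the infimum over parametric
representations of their uniform distance. -/
def m1DistUpTo (f g : ℝ → ℝ) (t : ℝ) : ℝ≥0∞ :=
  ⨅ (γ : ℝ → ℝ × ℝ) (_ : IsParametricRep f t γ) (γ' : ℝ → ℝ × ℝ) (_ : IsParametricRep g t γ'),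
    ⨆ u ∈ Icc (-1) t, edist (γ u) (γ' u)

/-- The `M1` distance `∫₀^∞ e^{-t} (1 ∧ d(f|[-1,t], g|[-1,t])) dt`. -/
def m1Dist (f g : ℝ → ℝ) : ℝ≥0∞ :=
  ∫⁻ t in Ioi (0 : ℝ), ENNReal.ofReal (Real.exp (-t)) * min 1 (m1DistUpTo f g t)

/-! ### The distance between spatial trees -/

namespace SpatialTree

variable {α : ℝ}

/-- `C` is a correspondence between the closed balls of radius `r` around the base points which
contains the pair of base points. -/
def IsCorrespondence (ζ ζ' : SpatialTree α) (r : ℝ) (C : Set (ζ.carrier × ζ'.carrier)) : Prop :=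
  (∀ p ∈ C, p.1 ∈ Metric.closedBall ζ.base r ∧ p.2 ∈ Metric.closedBall ζ'.base r) ∧
  (∀ z ∈ Metric.closedBall ζ.base r, ∃ z', (z, z') ∈ C) ∧
  (∀ z' ∈ Metric.closedBall ζ'.base r, ∃ z, (z, z') ∈ C) ∧
  (ζ.base, ζ'.base) ∈ C

/-- The distortion of `C`. -/
def distortion (ζ ζ' : SpatialTree α) (C : Set (ζ.carrier × ζ'.carrier)) : ℝ≥0∞ :=
  ⨆ p ∈ C, ⨆ q ∈ C, ENNReal.ofReal |dist p.1 q.1 - dist p.2 q.2|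

/-- The dyadic scale `(2^{-n}, 2^{-(n-1)}]`. -/
def dyadicScale (n : ℕ) : Set ℝ := Ioc ((2 : ℝ) ^ (-(n : ℝ))) ((2 : ℝ) ^ (-((n : ℝ) - 1)))

open Classical in
/-- The supremum of `‖δM - δM'‖` over pairs of couples at scale `n` in both trees; if in one tree
there is no pair at scale `n`, the increment in that tree is dropped and the supremum is over the
pairs at scale `n` in the other tree. -/
def incrementGap (ζ ζ' : SpatialTree α) (C : Set (ζ.carrier × ζ'.carrier)) (n : ℕ) : ℝ≥0∞ :=
  if ∃ p ∈ C, ∃ q ∈ C, dist p.1 q.1 ∈ dyadicScale n then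
    if ∃ p ∈ C, ∃ q ∈ C, dist p.2 q.2 ∈ dyadicScale n then
      ⨆ (p ∈ C) (q ∈ C) (_ : dist p.1 q.1 ∈ dyadicScale n) (_ : dist p.2 q.2 ∈ dyadicScale n),
        ENNReal.ofReal ‖(ζ.eval p.1 - ζ.eval q.1) - (ζ'.eval p.2 - ζ'.eval q.2)‖
    else
      ⨆ (p ∈ C) (q ∈ C) (_ : dist p.1 q.1 ∈ dyadicScale n),
        ENNReal.ofReal ‖ζ.eval p.1 - ζ.eval q.1‖
  else
    ⨆ (p ∈ C) (q ∈ C) (_ : dist p.2 q.2 ∈ dyadicScale n),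
      ENNReal.ofReal ‖ζ'.eval p.2 - ζ'.eval q.2‖

/-- The cost of a correspondence: half the distortion, plus the uniform distance of the evaluation
maps, plus the dyadic `α`-Hölder distance of their increments. -/
def correspondenceCost (ζ ζ' : SpatialTree α) (C : Set (ζ.carrier × ζ'.carrier)) : ℝ≥0∞ :=
  distortion ζ ζ' C / 2
    + (⨆ p ∈ C, ENNReal.ofReal ‖ζ.eval p.1 - ζ'.eval p.2‖)
    + ⨆ (n : ℕ) (_ : 1 ≤ n), ENNReal.ofReal ((2 : ℝ) ^ ((n : ℝ) * α)) * incrementGap ζ ζ' C n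

/-- The distance of the closed balls of radius `r`. -/
def ballDist (ζ ζ' : SpatialTree α) (r : ℝ) : ℝ≥0∞ :=
  ⨅ (C : Set (ζ.carrier × ζ'.carrier)) (_ : IsCorrespondence ζ ζ' r C), correspondenceCost ζ ζ' C

/-- The distance `Δ_sp`. -/
def treeDist (ζ ζ' : SpatialTree α) : ℝ≥0∞ :=
  (∫⁻ r in Ioi (0 : ℝ), ENNReal.ofReal (Real.exp (-r)) * min 1 (ballDist ζ ζ' r))
    + m1Dist ζ.properness ζ'.properness

end SpatialTree

/-! ### The space of backward paths -/

/-- `tanh` on `[-∞, ∞]`. -/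
def tanhE : EReal → ℝ
  | ⊥ => -1
  | ⊤ => 1
  | (x : ℝ) => Real.tanh x

theorem tanhE_bot : tanhE ⊥ = -1 := rfl

theorem tanhE_top : tanhE ⊤ = 1 := rfl

theorem tanhE_coe (x : ℝ) : tanhE x = Real.tanh x := rfl

/-- A backward path with starting time `start ∈ [-∞, ∞]`, constant on `[start, ∞)`. At finite times
the compactified plane is `ℝ × [-∞, ∞]`, whereas each of the lines at time `±∞` is a single point.
Hence there is only one path with starting time `-∞`; it is represented by the zero function. -/
@[ext]
structure BackwardPath where
  start : EReal
  toFun : ℝ → EReal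
  continuous_toFun : Continuous toFun
  const_after : ∀ s t : ℝ, start ≤ s → start ≤ t → toFun s = toFun t
  of_start_bot : start = ⊥ → ∀ t, toFun t = 0

namespace BackwardPath

/-- The stopped time `t ∧ start`, as a real number. -/
def stopped (π : BackwardPath) (t : ℝ) : ℝ := (min (t : EReal) π.start).toReal

/-- The (rescaled) spatial coordinate `tanh(π(t)) / (1 + |t|)` at the stopped time `t ∧ start`
(it is `0` if `start = -∞`). -/
def coord (π : BackwardPath) (t : ℝ) : ℝ := tanhE (π.toFun (π.stopped t)) / (1 + |π.stopped t|)

/-- The uniform distance, in the compactified plane with the metric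
`|tanh t₁ - tanh t₂| ∨ |tanh(x₁) / (1 + |t₁|) - tanh(x₂) / (1 + |t₂|)|`, between the stopped
trajectories `t ↦ (t ∧ start, π(t ∧ start))`. -/
def pathDist (π₁ π₂ : BackwardPath) : ℝ :=
  max |tanhE π₁.start - tanhE π₂.start| (⨆ t : ℝ, |π₁.coord t - π₂.coord t|)

theorem abs_tanhE_le (x : EReal) : |tanhE x| ≤ 1 := by
  induction x with
  | bot => simp [tanhE_bot]
  | top => simp [tanhE_top]
  | coe x => exact (Real.abs_tanh_lt_one x).le

theorem tanhE_injective : Function.Injective tanhE := by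
  intro x y h
  induction x <;> induction y <;> simp only [tanhE_bot, tanhE_top, tanhE_coe] at h
  all_goals first
    | rfl
    | (exfalso; norm_num at h; done)
    | (exfalso; linarith [Real.tanh_lt_one ‹ℝ›, Real.neg_one_lt_tanh ‹ℝ›])
    | exact congrArg _ (Real.tanh_injective h)

theorem abs_coord_le (π : BackwardPath) (t : ℝ) : |π.coord t| ≤ 1 := by
  have h1 : 0 < 1 + |π.stopped t| := by positivity
  rw [coord, abs_div, abs_of_pos h1, div_le_one h1]
  linarith [abs_tanhE_le (π.toFun (π.stopped t)), abs_nonneg (π.stopped t)]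

theorem bddAbove_coord (π₁ π₂ : BackwardPath) :
    BddAbove (range fun t : ℝ => |π₁.coord t - π₂.coord t|) := by
  refine ⟨2, ?_⟩
  rintro _ ⟨t, rfl⟩
  have := abs_sub (π₁.coord t) (π₂.coord t)
  linarith [abs_coord_le π₁ t, abs_coord_le π₂ t]

theorem toFun_stopped (π : BackwardPath) (h : π.start ≠ ⊥) (t : ℝ) :
    π.toFun (π.stopped t) = π.toFun t := by
  rcases le_total (t : EReal) π.start with h1 | h1
  · simp [stopped, min_eq_left h1]
  · have h2 : π.start ≠ ⊤ := fun h3 => by simp [h3] at h1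
    refine π.const_after _ _ ?_ h1
    rw [stopped, min_eq_right h1, EReal.coe_toReal h2 h]

theorem eq_of_pathDist_eq_zero {π₁ π₂ : BackwardPath} (h : pathDist π₁ π₂ = 0) : π₁ = π₂ := by
  have h0 : |tanhE π₁.start - tanhE π₂.start| = 0 :=
    le_antisymm ((le_max_left _ _).trans h.le) (abs_nonneg _)
  have hs : π₁.start = π₂.start := tanhE_injective (sub_eq_zero.1 (abs_eq_zero.1 h0))
  have hc : ∀ t, π₁.coord t = π₂.coord t := fun t => by
    have h1 : |π₁.coord t - π₂.coord t| ≤ 0 :=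
      (le_ciSup (bddAbove_coord π₁ π₂) t).trans ((le_max_right _ _).trans h.le)
    exact sub_eq_zero.1 (abs_eq_zero.1 (le_antisymm h1 (abs_nonneg _)))
  refine BackwardPath.ext hs (funext fun t => ?_)
  by_cases hb : π₁.start = ⊥
  · rw [π₁.of_start_bot hb, π₂.of_start_bot (hs ▸ hb)]
  · have h1 := hc t
    have h2 : π₁.stopped t = π₂.stopped t := by rw [stopped, stopped, hs]
    have h3 : (1 + |π₂.stopped t|) ≠ 0 := by positivity
    rw [coord, coord, toFun_stopped π₁ hb, toFun_stopped π₂ (hs ▸ hb), h2, div_left_inj' h3] at h1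
    exact tanhE_injective h1

instance : MetricSpace BackwardPath where
  dist := pathDist
  dist_self π := by simp [pathDist]
  dist_comm π₁ π₂ := by simp only [pathDist, abs_sub_comm]
  dist_triangle π₁ π₂ π₃ := by
    refine max_le ?_ (ciSup_le fun t => ?_)
    · exact (abs_sub_le _ (tanhE π₂.start) _).trans
        (add_le_add (le_max_left _ _) (le_max_left _ _))
    · exact (abs_sub_le _ (π₂.coord t) _).trans
        (add_le_add ((le_ciSup (bddAbove_coord π₁ π₂) t).trans (le_max_right _ _))
          ((le_ciSup (bddAbove_coord π₂ π₃) t).trans (le_max_right _ _)))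
  eq_of_dist_eq_zero := eq_of_pathDist_eq_zero

end BackwardPath

/-! ### Characteristic trees, radial rays and the map `K` -/

/-- Representatives of characteristic `α`-spatial `ℝ`-trees. -/
structure CharTree (α : ℝ) extends SpatialTree α where
  isCharacteristic : toSpatialTree.IsCharacteristic

namespace CharTree

variable {α : ℝ}

/-- Trees are identified when there is a bijective isometry preserving base points and evaluation
maps. -/
instance instSetoid (α : ℝ) : Setoid (CharTree α) where
  r ζ ζ' := ζ.toSpatialTree.Isomorphic ζ'.toSpatialTree
  iseqv :=
    { refl := fun ζ => ⟨IsometryEquiv.refl _, rfl, fun _ => rfl⟩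
      symm := by
        rintro ζ ζ' ⟨φ, hb, he⟩
        refine ⟨φ.symm, ?_, fun z => ?_⟩
        · rw [← hb, φ.symm_apply_apply]
        · rw [← he, φ.apply_symm_apply]
      trans := by
        rintro ζ₁ ζ₂ ζ₃ ⟨φ, hb, he⟩ ⟨ψ, hb', he'⟩
        refine ⟨φ.trans ψ, ?_, fun z => ?_⟩
        · simp [hb, hb']
        · simp [he, he'] }

/-- The topology of the distance `Δ_sp`. -/
instance : TopologicalSpace (CharTree α) where
  IsOpen U := ∀ ζ ∈ U, ∃ ε : ℝ≥0∞, 0 < ε ∧ ∀ ζ' : CharTree α,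
    SpatialTree.treeDist ζ.toSpatialTree ζ'.toSpatialTree < ε → ζ' ∈ U
  isOpen_univ := fun _ _ => ⟨1, one_pos, fun _ _ => mem_univ _⟩
  isOpen_inter := fun U V hU hV ζ hζ => by
    obtain ⟨ε, hε, h⟩ := hU ζ hζ.1
    obtain ⟨δ, hδ, h'⟩ := hV ζ hζ.2
    exact ⟨min ε δ, lt_min hε hδ, fun ζ' hd =>
      ⟨h ζ' (hd.trans_le (min_le_left _ _)), h' ζ' (hd.trans_le (min_le_right _ _))⟩⟩
  isOpen_sUnion := fun S hS ζ ⟨U, hU, hζ⟩ => by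
    obtain ⟨ε, hε, h⟩ := hS U hU ζ hζ
    exact ⟨ε, hε, fun ζ' hd => ⟨U, hU, h ζ' hd⟩⟩

/-- `e` is the distinguished open end `†`: along each of its rays time decreases at unit speed,
`M_t(w) = M_t(z) - d(z, w)` for `w ∈ ⟦z, †⟩`. -/
def IsRoot (ζ : CharTree α) (e : UnboundedEnd ζ.carrier) : Prop :=
  ∀ (z : ζ.carrier) (u : ℝ≥0), ζ.time (e.ray z u) = ζ.time z - u

/-- The radial map `ρ(z, s) = ι_z⁻¹(M_t(z) - s)` for `s ≤ M_t(z)` (and `ρ(z, s) = z` for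
`s ≥ M_t(z)`). -/
def radial (ζ : CharTree α) (e : UnboundedEnd ζ.carrier) (z : ζ.carrier) (s : ℝ) : ζ.carrier :=
  e.ray z (ζ.time z - s).toNNReal

/-- The path `π_z(s) = M_x(ρ(z, s))`, started at time `M_t(z)`. -/
def radialPath (ζ : CharTree α) (e : UnboundedEnd ζ.carrier) (z : ζ.carrier) : BackwardPath where
  start := (ζ.time z : EReal)
  toFun s := (ζ.space (ζ.radial e z s) : EReal)
  continuous_toFun := by
    have h1 : Continuous (ζ.radial e z) :=
      (e.isometry_ray z).continuous.comp
        (continuous_real_toNNReal.comp (continuous_const.sub continuous_id))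
    have h2 : Continuous fun s => ζ.space (ζ.radial e z s) :=
      ((EuclideanSpace.proj (𝕜 := ℝ) (1 : Fin 2)).continuous.comp ζ.proper.continuous).comp h1
    exact continuous_coe_real_ereal.comp h2
  const_after s t hs ht := by
    have hs' : ζ.time z - s ≤ 0 := sub_nonpos.2 (EReal.coe_le_coe_iff.1 hs)
    have ht' : ζ.time z - t ≤ 0 := sub_nonpos.2 (EReal.coe_le_coe_iff.1 ht)
    simp only [radial, Real.toNNReal_of_nonpos hs', Real.toNNReal_of_nonpos ht']
  of_start_bot h := absurd h (EReal.coe_ne_bot _)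

/-- The set of paths traced by the radial rays. The end `†` exists and is unique for every
characteristic tree. -/
def pathSet (ζ : CharTree α) : Set BackwardPath :=
  {π | ∃ e : UnboundedEnd ζ.carrier, ζ.IsRoot e ∧ ∃ z : ζ.carrier, π = ζ.radialPath e z}

theorem pathSet_subset {ζ ζ' : CharTree α} (h : ζ ≈ ζ') : ζ.pathSet ⊆ ζ'.pathSet := by
  obtain ⟨φ, -, he⟩ := h
  rintro _ ⟨e, hroot, z, rfl⟩
  have ht : ∀ w, ζ'.time (φ w) = ζ.time w := fun w => by simp only [SpatialTree.time, he]
  have hx : ∀ w, ζ'.space (φ w) = ζ.space w := fun w => by simp only [SpatialTree.space, he]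
  let e' : UnboundedEnd ζ'.carrier :=
    { ray := fun w u => φ (e.ray (φ.symm w) u)
      isometry_ray := fun w => φ.isometry.comp (e.isometry_ray _)
      ray_zero := fun w => by rw [e.ray_zero, φ.apply_symm_apply]
      equiv := fun w w' => by
        obtain ⟨a, b, hab⟩ := e.equiv (φ.symm w) (φ.symm w')
        exact ⟨a, b, fun u => by rw [hab]⟩ }
  refine ⟨e', fun w u => ?_, φ z, ?_⟩
  · change ζ'.time (φ (e.ray (φ.symm w) u)) = _
    rw [ht, hroot, ← ht (φ.symm w), φ.apply_symm_apply]
  · refine BackwardPath.ext ?_ (funext fun s => ?_)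
    · simp only [radialPath, ht]
    · simp only [radialPath, radial, e', ht, hx, φ.symm_apply_apply]

theorem pathSet_eq {ζ ζ' : CharTree α} (h : ζ ≈ ζ') : ζ.pathSet = ζ'.pathSet :=
  Subset.antisymm (pathSet_subset h) (pathSet_subset (Setoid.symm h))

end CharTree

/-- The space of characteristic `α`-spatial `ℝ`-trees, with the topology of `Δ_sp`. -/
def CharSpace (α : ℝ) : Type 1 := Quotient (CharTree.instSetoid α)

instance (α : ℝ) : TopologicalSpace (CharSpace α) :=
  inferInstanceAs (TopologicalSpace (Quotient (CharTree.instSetoid α)))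

/-- `K(ζ)`: the closure in the path space of the set of paths traced by the radial rays. -/
def radialPathSet {α : ℝ} (ζ : CharSpace α) : Set BackwardPath :=
  Quotient.lift (fun ζ : CharTree α => closure ζ.pathSet)
    (fun _ _ h => congrArg closure (CharTree.pathSet_eq h)) ζ

end

/-! ### The hyperbolic tangent on the extended line -/

open Filter

/-! The root end comes from condition 1 and spread: the geodesic from `z` to a point at time `M_t(z)
- u` must descend at unit speed for length `u`. Such descents are unique, and those from `z` and `w`
merge at the lowest point of the geodesic joining `z` and `w`.

Two facts then control the paths. First, far regions contribute little. The path metric damps times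
below `-R` and above `R` by `1 / (1 + R)`, and `tanh` nearly identifies all positions beyond `R`, or
all below `-R`. After truncation at time `R`, a path of any tree is of one of three kinds
(`exists_radius_forall_path_near`). It may start before `-R`, and is then close to any other such
path. It may visit the box `[-R, R]²` after time `-R`, and then its starting point lies within `b(R)
+ 2R` of the base point. Otherwise it stays on one side of the box, and by spread the reference tree
`ζ` has a path with the same starting time on the same side, starting in a ball that depends only on
`ζ` and `R`.

Second, rays are determined by distances and times. If a correspondence distorts these little, it
almost matches `ρ(z, s)` with `ρ(z', s)`, and uniform continuity of `M_x` on a ball of `ζ` makes the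
paths close (`dist_path_le_of_relation`).

Compactness: up to a small error only starting points in one ball matter; it is compact by
Hopf-Rinow, `z ↦ π_z` is continuous, and the path space is complete. Continuity
(`exists_treeDist_lt_path_near`): the M1 part of the distance bounds `b_{ζ'}(R)` by `b_ζ(R + 1) +
1`, so one large ball serves both trees, and the integral part supplies a good correspondence on it.
-/

theorem hasDerivAt_real_tanh (x : ℝ) : HasDerivAt Real.tanh (1 / Real.cosh x ^ 2) x := by
  have h := (Real.hasDerivAt_sinh x).div (Real.hasDerivAt_cosh x) (Real.cosh_pos x).ne'
  rw [← sq, ← sq, Real.cosh_sq, add_sub_cancel_left, ← Real.cosh_sq] at h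
  exact h.congr_of_eventuallyEq (Eventually.of_forall Real.tanh_eq_sinh_div_cosh)

theorem strictMono_real_tanh : StrictMono Real.tanh := by
  refine strictMono_of_deriv_pos fun x => ?_
  rw [(hasDerivAt_real_tanh x).deriv]
  have := Real.cosh_pos x
  positivity

theorem abs_tanh_sub_tanh_le (x y : ℝ) : |Real.tanh x - Real.tanh y| ≤ |x - y| := by
  have := Convex.norm_image_sub_le_of_norm_deriv_le (f := Real.tanh) (s := univ) (C := 1)
    (fun x _ => (hasDerivAt_real_tanh x).differentiableAt) (fun x _ => by
      rw [(hasDerivAt_real_tanh x).deriv, Real.norm_eq_abs, abs_of_nonneg (by positivity)]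
      exact div_le_one_of_le₀ (one_le_pow₀ (Real.one_le_cosh x)) (by positivity))
    convex_univ (mem_univ y) (mem_univ x)
  simpa using this

/-- A crude bound, of the same form as the damping factor `1 / (1 + |t|)` of the path metric, so
that errors in space and in time add up. -/
theorem one_sub_tanh_le {x : ℝ} (hx : 0 ≤ x) : 1 - Real.tanh x ≤ 1 / (1 + x) := by
  have h1 : 0 < Real.exp x + Real.exp (-x) := by positivity
  have h2 : 1 - Real.tanh x = 2 * Real.exp (-x) / (Real.exp x + Real.exp (-x)) := by
    rw [Real.tanh_eq]; field_simp; ring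
  rw [h2, div_le_div_iff₀ h1 (by positivity)]
  have h3 : 1 + 2 * x ≤ Real.exp (2 * x) := by linarith [Real.add_one_le_exp (2 * x)]
  have h4 : Real.exp x = Real.exp (2 * x) * Real.exp (-x) := by rw [← Real.exp_add]; ring_nf
  have h5 := Real.exp_pos (-x)
  rw [h4]
  nlinarith

theorem abs_tanh_sub_tanh_le_of_le {L x y : ℝ} (hL : 0 ≤ L) (hx : L ≤ x) (hy : L ≤ y) :
    |Real.tanh x - Real.tanh y| ≤ 1 / (1 + L) := by
  have h := one_sub_tanh_le hL
  have h1 := strictMono_real_tanh.monotone hx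
  have h2 := strictMono_real_tanh.monotone hy
  have h3 := Real.tanh_lt_one x
  have h4 := Real.tanh_lt_one y
  rw [abs_le]; constructor <;> linarith

theorem abs_tanh_sub_tanh_le_of_le_neg {L x y : ℝ} (hL : 0 ≤ L) (hx : x ≤ -L) (hy : y ≤ -L) :
    |Real.tanh x - Real.tanh y| ≤ 1 / (1 + L) := by
  have h := abs_tanh_sub_tanh_le_of_le hL (le_neg_of_le_neg hx) (le_neg_of_le_neg hy)
  rwa [Real.tanh_neg, Real.tanh_neg, neg_sub_neg, abs_sub_comm] at h

theorem strictMono_tanhE : StrictMono tanhE := by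
  intro x y h
  refine lt_of_le_of_ne ?_ fun h' => h.ne (BackwardPath.tanhE_injective h')
  induction x with
  | bot => exact (abs_le.1 (BackwardPath.abs_tanhE_le y)).1
  | top => simp at h
  | coe x =>
    induction y with
    | bot => simp at h
    | top => exact (abs_le.1 (BackwardPath.abs_tanhE_le _)).2
    | coe y => exact strictMono_real_tanh.monotone (EReal.coe_lt_coe_iff.1 h).le

/-- `tanh` as an order isomorphism of `[-∞, ∞]` onto `[-1, 1]`. -/
noncomputable def tanhEIso : EReal ≃o Icc (-1 : ℝ) 1 :=
  StrictMono.orderIsoOfSurjective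
    (fun x => (⟨tanhE x, abs_le.1 (BackwardPath.abs_tanhE_le x)⟩ : Icc (-1 : ℝ) 1))
    (fun _ _ h => strictMono_tanhE h) (by
      rintro ⟨y, h1, h2⟩
      rcases h1.eq_or_lt with h1 | h1
      · exact ⟨⊥, Subtype.ext (by simp [tanhE_bot, ← h1])⟩
      rcases h2.eq_or_lt with h2 | h2
      · exact ⟨⊤, Subtype.ext (by simp [tanhE_top, h2])⟩
      · exact ⟨(Real.artanh y : ℝ), Subtype.ext (Real.tanh_artanh ⟨h1, h2⟩)⟩)

theorem coe_tanhEIso (x : EReal) : (tanhEIso x : ℝ) = tanhE x := rfl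

theorem tanhE_tanhEIso_symm (y : Icc (-1 : ℝ) 1) : tanhE (tanhEIso.symm y) = y := by
  rw [← coe_tanhEIso, OrderIso.apply_symm_apply]

theorem continuous_tanhE : Continuous tanhE :=
  continuous_subtype_val.comp tanhEIso.continuous

theorem tendsto_of_tendsto_tanhE {ι : Type*} {l : Filter ι} {u : ι → EReal} {x : EReal}
    (h : Tendsto (fun i => tanhE (u i)) l (𝓝 (tanhE x))) : Tendsto u l (𝓝 x) := by
  have h1 : Tendsto (fun i => tanhEIso (u i)) l (𝓝 (tanhEIso x)) :=
    tendsto_subtype_rng.2 h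
  simpa [Function.comp_def] using (tanhEIso.symm.continuous.tendsto _).comp h1

/-! ### Completeness of the space of backward paths -/

namespace BackwardPath

theorem dist_def (π₁ π₂ : BackwardPath) : dist π₁ π₂ = pathDist π₁ π₂ := rfl

theorem dist_le_iff {π₁ π₂ : BackwardPath} {c : ℝ} :
    dist π₁ π₂ ≤ c ↔ |tanhE π₁.start - tanhE π₂.start| ≤ c ∧
      ∀ t, |π₁.coord t - π₂.coord t| ≤ c := by
  rw [dist_def, pathDist, max_le_iff]
  exact and_congr_right fun _ => ciSup_le_iff (bddAbove_coord π₁ π₂)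

theorem abs_coord_le_one_div (π : BackwardPath) (t : ℝ) :
    |π.coord t| ≤ 1 / (1 + |π.stopped t|) := by
  have h1 : 0 < 1 + |π.stopped t| := by positivity
  rw [coord, abs_div, abs_of_pos h1]
  gcongr
  exact abs_tanhE_le _

theorem coe_stopped {π : BackwardPath} (h : π.start ≠ ⊥) (t : ℝ) :
    (π.stopped t : EReal) = min (t : EReal) π.start := by
  refine EReal.coe_toReal ?_ ?_
  · exact ((min_le_left _ _).trans_lt (EReal.coe_lt_top t)).ne
  · exact (lt_min (EReal.bot_lt_coe t) (bot_lt_iff_ne_bot.2 h)).ne'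

theorem coord_of_start_bot {π : BackwardPath} (h : π.start = ⊥) (t : ℝ) : π.coord t = 0 := by
  rw [coord, π.of_start_bot h, ← EReal.coe_zero, tanhE_coe, Real.tanh_zero, zero_div]

theorem tendsto_stopped {ι : Type*} {l : Filter ι} {u : ι → EReal} {σ : EReal} (hσ : σ ≠ ⊥)
    (h : Tendsto u l (𝓝 σ)) (t : ℝ) :
    Tendsto (fun i => (min (t : EReal) (u i)).toReal) l (𝓝 (min (t : EReal) σ).toReal) := by
  refine (EReal.tendsto_toReal ?_ ?_).comp (tendsto_const_nhds.min h)
  · exact ((min_le_left _ _).trans_lt (EReal.coe_lt_top t)).ne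
  · exact (lt_min (EReal.bot_lt_coe t) (bot_lt_iff_ne_bot.2 hσ)).ne'

theorem continuous_toReal_min {σ : EReal} (hσ : σ ≠ ⊥) :
    Continuous fun t : ℝ => (min (t : EReal) σ).toReal := by
  refine continuous_iff_continuousAt.2 fun t => ?_
  refine (EReal.tendsto_toReal ?_ ?_).comp
    ((continuous_coe_real_ereal.min continuous_const).tendsto t)
  · exact ((min_le_left _ _).trans_lt (EReal.coe_lt_top t)).ne
  · exact (lt_min (EReal.bot_lt_coe t) (bot_lt_iff_ne_bot.2 hσ)).ne'

theorem coord_stopped {π : BackwardPath} (h : π.start ≠ ⊥) (t : ℝ) :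
    π.coord (π.stopped t) = π.coord t := by
  have : π.stopped (π.stopped t) = π.stopped t := by
    rw [stopped, coe_stopped h, min_assoc, min_self, stopped]
  rw [coord, this, coord]

theorem continuous_coord (π : BackwardPath) : Continuous π.coord := by
  by_cases h : π.start = ⊥
  · exact (continuous_const (y := (0 : ℝ))).congr fun t => (coord_of_start_bot h t).symm
  · have h1 : Continuous π.stopped := continuous_toReal_min h
    refine (continuous_tanhE.comp (π.continuous_toFun.comp h1)).div
      (continuous_const.add h1.abs) fun t => ?_
    positivity

/-- The path with starting time `-∞`. -/
noncomputable def atBot : BackwardPath where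
  start := ⊥
  toFun _ := 0
  continuous_toFun := continuous_const
  const_after _ _ _ _ := rfl
  of_start_bot _ _ := rfl

/-- Coordinates are at most `1 / (1 + |t ∧ start|)`, which tends to `0` uniformly in `t` as the
starting times tend to `-∞`. -/
theorem tendsto_atBot {π : ℕ → BackwardPath}
    (h : Tendsto (fun n => (π n).start) atTop (𝓝 ⊥)) : Tendsto π atTop (𝓝 atBot) := by
  rw [Metric.tendsto_atTop]
  intro ε hε
  have h1 : Tendsto (fun n => tanhE (π n).start) atTop (𝓝 (tanhE ⊥)) :=
    (continuous_tanhE.tendsto _).comp h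
  obtain ⟨N, hN⟩ := Metric.tendsto_atTop.1 h1 (ε / 2) (by positivity)
  obtain ⟨N', hN'⟩ := eventually_atTop.1
    (h.eventually (gt_mem_nhds (EReal.bot_lt_coe (-(2 / ε)))))
  refine ⟨max N N', fun n hn => ?_⟩
  refine lt_of_le_of_lt (dist_le_iff.2 ⟨?_, fun t => ?_⟩) (half_lt_self hε)
  · exact (hN n ((le_max_left _ _).trans hn)).le
  · rw [coord_of_start_bot (π := atBot) rfl, sub_zero]
    by_cases hb : (π n).start = ⊥
    · rw [coord_of_start_bot hb, abs_zero]; positivity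
    refine (abs_coord_le_one_div _ t).trans ?_
    have h2 : (π n).stopped t < -(2 / ε) := by
      rw [← EReal.coe_lt_coe_iff, coe_stopped hb]
      exact (min_le_right _ _).trans_lt (hN' n ((le_max_right _ _).trans hn))
    have h3 : 2 / ε ≤ 1 + |(π n).stopped t| := by
      linarith [neg_le_abs ((π n).stopped t)]
    calc 1 / (1 + |(π n).stopped t|) ≤ 1 / (2 / ε) :=
          one_div_le_one_div_of_le (by positivity) h3
      _ = ε / 2 := by rw [one_div_div]

theorem exists_tendsto_of_tendstoUniformly {π : ℕ → BackwardPath} {σ : EReal} {F : ℝ → ℝ}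
    (hσ : σ ≠ ⊥) (hs : Tendsto (fun n => (π n).start) atTop (𝓝 σ))
    (hF : TendstoUniformly (fun n => (π n).coord) F atTop) :
    ∃ π₀, Tendsto π atTop (𝓝 π₀) := by
  have hFc : Continuous F :=
    hF.continuous (Frequently.of_forall fun n => (π n).continuous_coord)
  have hne : ∀ᶠ n in atTop, (π n).start ≠ ⊥ := hs.eventually_ne hσ
  let S : ℝ → ℝ := fun t => (min (t : EReal) σ).toReal
  have hSc : Continuous S := continuous_toReal_min hσ
  have hS : ∀ t, Tendsto (fun n => (π n).stopped t) atTop (𝓝 (S t)) := tendsto_stopped hσ hs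
  -- The stopping property passes to the limit: uniform convergence allows evaluation at the moving
  -- points `(π n).stopped t`.
  have hFS : ∀ t, F (S t) = F t := fun t => by
    have h1 : Tendsto (fun n => (π n).coord ((π n).stopped t)) atTop (𝓝 (F (S t))) :=
      hF.tendsto_comp hFc.continuousAt (hS t)
    refine tendsto_nhds_unique (h1.congr' ?_) (hF.tendsto_at t)
    exact hne.mono fun n hn => coord_stopped hn t
  -- Undoing the damping: `H t` is the limit of `tanh` of the stopped paths, so inverting `tanh` on
  -- `[-1, 1]` recovers the limit path.
  let H : ℝ → ℝ := fun t => F t * (1 + |S t|)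
  have hH : ∀ t, H t ∈ Icc (-1 : ℝ) 1 := fun t => by
    have h1 : Tendsto (fun n => (π n).coord t * (1 + |(π n).stopped t|)) atTop (𝓝 (H t)) :=
      (hF.tendsto_at t).mul (tendsto_const_nhds.add (hS t).abs)
    refine isClosed_Icc.mem_of_tendsto h1 (Eventually.of_forall fun n => ?_)
    rw [coord, div_mul_cancel₀ _ (by positivity)]
    exact abs_le.1 (abs_tanhE_le _)
  have hSS : ∀ t, S (S t) = S t := fun t => by
    have h0 : (S t : EReal) = min (t : EReal) σ := EReal.coe_toReal
      (((min_le_left _ _).trans_lt (EReal.coe_lt_top t)).ne)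
      ((lt_min (EReal.bot_lt_coe t) (bot_lt_iff_ne_bot.2 hσ)).ne')
    change (min (S t : EReal) σ).toReal = S t
    rw [h0, min_assoc, min_self]
  let π₀ : BackwardPath :=
    { start := σ
      toFun := fun t => tanhEIso.symm ⟨H t, hH t⟩
      continuous_toFun := tanhEIso.symm.continuous.comp
        ((hFc.mul (continuous_const.add hSc.abs)).subtype_mk hH)
      const_after := fun s t h1 h2 => by
        have h3 : S s = S t := by
          change (min (s : EReal) σ).toReal = (min (t : EReal) σ).toReal
          rw [min_eq_right h1, min_eq_right h2]
        have h4 : H s = H t := by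
          change F s * _ = F t * _
          rw [← hFS s, ← hFS t, h3]
        simp only [h4]
      of_start_bot := fun h => absurd h hσ }
  have hcoord : ∀ t, π₀.coord t = F t := fun t => by
    change tanhE (tanhEIso.symm ⟨H (S t), hH (S t)⟩) / (1 + |S t|) = F t
    rw [tanhE_tanhEIso_symm, div_eq_iff (by positivity)]
    change F (S t) * (1 + |S (S t)|) = _
    rw [hFS, hSS]
  refine ⟨π₀, Metric.tendsto_atTop.2 fun ε hε => ?_⟩
  have h1 : Tendsto (fun n => tanhE (π n).start) atTop (𝓝 (tanhE σ)) :=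
    (continuous_tanhE.tendsto _).comp hs
  obtain ⟨N, hN⟩ := Metric.tendsto_atTop.1 h1 (ε / 2) (by positivity)
  obtain ⟨N', hN'⟩ := eventually_atTop.1 (Metric.tendstoUniformly_iff.1 hF (ε / 2) (by positivity))
  refine ⟨max N N', fun n hn => ?_⟩
  refine lt_of_le_of_lt (dist_le_iff.2 ⟨?_, fun t => ?_⟩) (half_lt_self hε)
  · exact (hN n ((le_max_left _ _).trans hn)).le
  · rw [hcoord, abs_sub_comm]
    exact (hN' n ((le_max_right _ _).trans hn) t).le

instance : CompleteSpace BackwardPath := by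
  refine Metric.complete_of_cauchySeq_tendsto fun π hπ => ?_
  have hstart : CauchySeq fun n => tanhE (π n).start := by
    rw [Metric.cauchySeq_iff] at hπ ⊢
    intro ε hε
    obtain ⟨N, hN⟩ := hπ ε hε
    exact ⟨N, fun m hm n hn => lt_of_le_of_lt (dist_le_iff.1 le_rfl).1 (hN m hm n hn)⟩
  have hcoord : UniformCauchySeqOn (fun n => (π n).coord) atTop univ := by
    rw [Metric.uniformCauchySeqOn_iff]
    intro ε hε
    obtain ⟨N, hN⟩ := Metric.cauchySeq_iff.1 hπ ε hε
    exact ⟨N, fun m hm n hn t _ => lt_of_le_of_lt ((dist_le_iff.1 le_rfl).2 t) (hN m hm n hn)⟩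
  obtain ⟨y, hy⟩ := cauchySeq_tendsto_of_complete hstart
  have hy1 : y ∈ Icc (-1 : ℝ) 1 := isClosed_Icc.mem_of_tendsto hy
    (Eventually.of_forall fun n => abs_le.1 (abs_tanhE_le _))
  have hs : Tendsto (fun n => (π n).start) atTop (𝓝 (tanhEIso.symm ⟨y, hy1⟩)) :=
    tendsto_of_tendsto_tanhE (by rwa [tanhE_tanhEIso_symm])
  choose F hF using fun t => cauchySeq_tendsto_of_complete (hcoord.cauchySeq (mem_univ t))
  have hF' : TendstoUniformly (fun n => (π n).coord) F atTop :=
    tendstoUniformlyOn_univ.1 (hcoord.tendstoUniformlyOn_of_tendsto fun t _ => hF t)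
  rcases eq_or_ne (tanhEIso.symm ⟨y, hy1⟩) ⊥ with hb | hb
  · exact ⟨atBot, tendsto_atBot (hb ▸ hs)⟩
  · exact exists_tendsto_of_tendstoUniformly hb hs hF'

end BackwardPath

/-! ### Geodesics and compactness of closed balls -/

/-- Moving along a geodesic towards the centre brings each point of the ball within `δ / 2` of a
smaller, compact ball. -/
theorem totallyBounded_closedBall_of_forall_lt {T : Type*} [MetricSpace T]
    (hg : ∀ z w : T, ∀ u ∈ Icc 0 (dist z w), ∃ v, dist z v = u ∧ dist v w = dist z w - u)
    {x : T} {R : ℝ} (hR : 0 < R) (h : ∀ r < R, IsCompact (Metric.closedBall x r)) :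
    TotallyBounded (Metric.closedBall x R) := by
  rw [Metric.totallyBounded_iff]
  intro δ hδ
  let r := max 0 (R - δ / 2)
  have hrR : r < R := max_lt hR (by linarith)
  obtain ⟨t, ht, hcov⟩ := Metric.totallyBounded_iff.1 (h r hrR).totallyBounded (δ / 2) (by positivity)
  refine ⟨t, ht, fun y hy => ?_⟩
  rw [Metric.mem_closedBall, dist_comm] at hy
  obtain ⟨v, hv1, hv2⟩ := hg x y (min r (dist x y))
    ⟨le_min (le_max_left _ _) dist_nonneg, min_le_right _ _⟩
  have hv : v ∈ Metric.closedBall x r := by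
    rw [Metric.mem_closedBall, dist_comm, hv1]; exact min_le_left _ _
  obtain ⟨c, hc, hvc⟩ := mem_iUnion₂.1 (hcov hv)
  refine mem_iUnion₂.2 ⟨c, hc, ?_⟩
  rw [Metric.mem_ball] at hvc ⊢
  have h1 : dist v y ≤ δ / 2 := by
    rw [hv2]
    rcases min_cases r (dist x y) with ⟨h1, _⟩ | ⟨h1, _⟩ <;> rw [h1]
    · linarith [le_max_right 0 (R - δ / 2)]
    · linarith
  linarith [dist_triangle y v c, dist_comm v y]

/-- The Hopf-Rinow theorem: closed balls of a complete locally compact geodesic space are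
compact. -/
theorem isCompact_closedBall_of_geodesic {T : Type*} [MetricSpace T] [CompleteSpace T]
    [LocallyCompactSpace T]
    (hg : ∀ z w : T, ∀ u ∈ Icc 0 (dist z w), ∃ v, dist z v = u ∧ dist v w = dist z w - u)
    (x : T) (r : ℝ) : IsCompact (Metric.closedBall x r) := by
  by_contra hr
  let S : Set ℝ := {r | IsCompact (Metric.closedBall x r)}
  have h0 : (0 : ℝ) ∈ S := by
    change IsCompact (Metric.closedBall x 0)
    rw [Metric.closedBall_zero]; exact isCompact_singleton
  have hdown : ∀ a ∈ S, ∀ b ≤ a, b ∈ S := fun a ha b hb =>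
    IsCompact.of_isClosed_subset ha Metric.isClosed_closedBall (Metric.closedBall_subset_closedBall hb)
  have hbdd : BddAbove S := ⟨r, fun a ha => le_of_not_gt fun h => hr (hdown a ha r h.le)⟩
  -- By local compactness a compact ball has a compact thickening, so no radius in `S` is maximal;
  -- yet the supremum of `S` will be seen to belong to `S`.
  have hext : ∀ a ∈ S, 0 ≤ a → ∃ b ∈ S, a < b := by
    intro a ha ha0
    obtain ⟨ε, hε, hc⟩ := IsCompact.exists_isCompact_cthickening ha
    refine ⟨a + ε, IsCompact.of_isClosed_subset hc Metric.isClosed_closedBall ?_, by linarith⟩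
    intro y hy
    rw [Metric.mem_closedBall, dist_comm] at hy
    obtain ⟨v, hv1, hv2⟩ := hg x y (min a (dist x y))
      ⟨le_min ha0 dist_nonneg, min_le_right _ _⟩
    refine Metric.mem_cthickening_of_dist_le y v ε _ ?_ ?_
    · rw [Metric.mem_closedBall, dist_comm, hv1]; exact min_le_left _ _
    · rw [dist_comm, hv2]
      rcases min_cases a (dist x y) with ⟨h1, _⟩ | ⟨h1, _⟩ <;> rw [h1] <;> linarith
  have hs0 : 0 ≤ sSup S := le_csSup hbdd h0
  have hlt : ∀ b < sSup S, IsCompact (Metric.closedBall x b) := fun b hb => by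
    obtain ⟨a, ha, hba⟩ := exists_lt_of_lt_csSup ⟨0, h0⟩ hb
    exact hdown a ha b hba.le
  have hs : sSup S ∈ S := by
    rcases hs0.eq_or_lt with h | h
    · rwa [← h]
    · exact isCompact_iff_totallyBounded_isComplete.2
        ⟨totallyBounded_closedBall_of_forall_lt hg h hlt, Metric.isClosed_closedBall.isComplete⟩
  obtain ⟨b, hb, hlt⟩ := hext _ hs hs0
  exact absurd (le_csSup hbdd hb) (not_le.2 hlt)

namespace IsRealTree

variable {T : Type} [MetricSpace T]

theorem dist_geodesicMap {z w : T} {f : Icc (0 : ℝ) (dist z w) → T} (hf : IsGeodesicMap z w f)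
    (t : Icc (0 : ℝ) (dist z w)) : dist z (f t) = t ∧ dist (f t) w = dist z w - t := by
  constructor
  · conv_lhs => rw [← hf.2.1]
    rw [hf.1.dist_eq, Subtype.dist_eq, dist_comm, Real.dist_eq, sub_zero, abs_of_nonneg t.2.1]
  · conv_lhs => rw [← hf.2.2]
    rw [hf.1.dist_eq, Subtype.dist_eq, dist_comm, Real.dist_eq, abs_of_nonneg (sub_nonneg.2 t.2.2)]

theorem exists_between (hT : IsRealTree T) (z w : T) (u : ℝ) (hu : u ∈ Icc 0 (dist z w)) :
    ∃ v, dist z v = u ∧ dist v w = dist z w - u := by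
  obtain ⟨f, hf, -⟩ := hT.existsUnique_geodesic z w
  exact ⟨f ⟨u, hu⟩, dist_geodesicMap hf ⟨u, hu⟩⟩

/-- The geodesics from `z` to `v` and from `v` to `w` concatenate to an isometric map, since
equality in the triangle inequality leaves no slack. Segments can thus be replaced by metric
betweenness. -/
theorem mem_geodesicSegment_of_dist_add (hT : IsRealTree T) {z v w : T}
    (h : dist z v + dist v w = dist z w) : v ∈ geodesicSegment z w := by
  obtain ⟨f, hf, -⟩ := hT.existsUnique_geodesic z v
  obtain ⟨g, hg, -⟩ := hT.existsUnique_geodesic v w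
  have hsub : ∀ t : Icc (0 : ℝ) (dist z w), ¬ (t : ℝ) ≤ dist z v →
      (t : ℝ) - dist z v ∈ Icc 0 (dist v w) := fun t ht =>
    ⟨by linarith, by linarith [t.2.2]⟩
  let k : Icc (0 : ℝ) (dist z w) → T := fun t =>
    if ht : (t : ℝ) ≤ dist z v then f ⟨t, t.2.1, ht⟩ else g ⟨t - dist z v, hsub t ht⟩
  have hmix : ∀ s t : Icc (0 : ℝ) (dist z w), ∀ hs : (s : ℝ) ≤ dist z v,
      ∀ ht : ¬ (t : ℝ) ≤ dist z v,
      dist (f ⟨s, s.2.1, hs⟩) (g ⟨t - dist z v, hsub t ht⟩) = t - s := by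
    intro s t hs ht
    have h1 := dist_geodesicMap hf ⟨s, s.2.1, hs⟩
    have h2 := dist_geodesicMap hg ⟨t - dist z v, hsub t ht⟩
    simp only at h1 h2
    set a := f ⟨s, s.2.1, hs⟩
    set b := g ⟨t - dist z v, hsub t ht⟩
    have h3 := dist_triangle4 z a b w
    have h4 := dist_triangle a v b
    apply le_antisymm <;> linarith [h1.1, h1.2, h2.1, h2.2]
  have hk : Isometry k := by
    refine Isometry.of_dist_eq fun s t => ?_
    rw [Subtype.dist_eq, Real.dist_eq]
    by_cases hs : (s : ℝ) ≤ dist z v <;> by_cases ht : (t : ℝ) ≤ dist z v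
    · simp only [k, dif_pos hs, dif_pos ht, hf.1.dist_eq, Subtype.dist_eq, Real.dist_eq]
    · simp only [k, dif_pos hs, dif_neg ht, hmix s t hs ht]
      rw [abs_sub_comm, abs_of_nonneg (by linarith)]
    · simp only [k, dif_neg hs, dif_pos ht]
      rw [dist_comm, hmix t s ht hs, abs_of_nonneg (by linarith)]
    · simp only [k, dif_neg hs, dif_neg ht, hg.1.dist_eq, Subtype.dist_eq, Real.dist_eq]
      rw [sub_sub_sub_cancel_right]
  have hv : k ⟨dist z v, dist_nonneg, by linarith [dist_nonneg (x := v) (y := w)]⟩ = v := by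
    simp only [k, dif_pos le_rfl]
    exact hf.2.2
  refine ⟨k, ⟨hk, ?_, ?_⟩, _, hv⟩
  · simp only [k, dif_pos (dist_nonneg (x := z) (y := v))]
    exact hf.2.1
  · by_cases hw : dist z w ≤ dist z v
    · have h1 : dist v w = 0 := le_antisymm (by linarith) dist_nonneg
      have h2 : v = w := dist_eq_zero.1 h1
      subst h2
      simp only [k, dif_pos hw]
      exact hf.2.2
    · simp only [k, dif_neg hw]
      refine Eq.trans ?_ hg.2.2
      congr 1
      exact Subtype.ext (by simp only; linarith)

theorem eq_of_dist_add (hT : IsRealTree T) {z v v' w : T} (h : dist z v + dist v w = dist z w)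
    (h' : dist z v' + dist v' w = dist z w) (he : dist z v = dist z v') : v = v' := by
  obtain ⟨f, hf, t, rfl⟩ := hT.mem_geodesicSegment_of_dist_add h
  obtain ⟨g, hg, t', rfl⟩ := hT.mem_geodesicSegment_of_dist_add h'
  obtain rfl := (hT.existsUnique_geodesic z w).unique hf hg
  rw [(dist_geodesicMap hf t).1, (dist_geodesicMap hf t').1] at he
  rw [Subtype.ext he]

end IsRealTree

/-! ### Descending rays of characteristic trees -/

namespace CharTree

variable {α : ℝ} (ζ : CharTree α)

theorem time_of_dist_add {z v w : ζ.carrier} (h : dist z v + dist v w = dist z w) :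
    ζ.time v = max (ζ.time z - dist z v) (ζ.time w - dist v w) := by
  rcases (dist_nonneg (x := z) (y := w)).eq_or_lt with h0 | h0
  · have h1 : dist z v = 0 := by
      linarith [dist_nonneg (x := z) (y := v), dist_nonneg (x := v) (y := w)]
    have h2 : dist v w = 0 := by linarith
    rw [h1, h2, dist_eq_zero.1 h1, dist_eq_zero.1 h2]
    simp
  · have h1 : dist z v / dist z w * dist z w = dist z v := div_mul_cancel₀ _ h0.ne'
    have h2 := ζ.isCharacteristic.monotone_time z w v (dist z v / dist z w)
      ⟨by positivity, div_le_one_of_le₀ (by linarith [dist_nonneg (x := v) (y := w)]) h0.le⟩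
      ⟨ζ.isRealTree.mem_geodesicSegment_of_dist_add h, h1.symm⟩
    rw [sub_mul, h1, one_mul] at h2
    rw [h2, ← h, add_sub_cancel_left]

/-- Condition 1 at the endpoint `w` itself; it makes `M_t` 1-Lipschitz. -/
theorem time_sub_dist_le (z w : ζ.carrier) : ζ.time z - dist z w ≤ ζ.time w := by
  have h := ζ.time_of_dist_add (z := z) (v := w) (w := w) (by simp)
  rw [h]
  exact le_max_left _ _

theorem abs_time_sub_le (z w : ζ.carrier) : |ζ.time z - ζ.time w| ≤ dist z w := by
  rw [abs_le]
  constructor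
  · linarith [ζ.time_sub_dist_le w z, dist_comm z w]
  · linarith [ζ.time_sub_dist_le z w]

/-- The lowest point of the geodesic from `z` to `w`. -/
theorem exists_lowest (z w : ζ.carrier) :
    ∃ m, ζ.time m = (ζ.time z + ζ.time w - dist z w) / 2 ∧
      dist z m = ζ.time z - ζ.time m ∧ dist w m = ζ.time w - ζ.time m := by
  have h1 := abs_le.1 (ζ.abs_time_sub_le z w)
  -- The distance from `z` at which the two terms of the maximum in condition 1 agree.
  obtain ⟨m, hm1, hm2⟩ := ζ.isRealTree.exists_between z w
    ((ζ.time z - ζ.time w + dist z w) / 2) ⟨by linarith, by linarith⟩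
  have h2 := ζ.time_of_dist_add (z := z) (v := m) (w := w) (by linarith)
  rw [hm2, hm1, max_eq_left (by linarith)] at h2
  refine ⟨m, by linarith, by linarith, ?_⟩
  rw [dist_comm, hm2]
  linarith

/-- Let `p` be the lowest point between `w` and `w'`. Descending from `z` to `p` through either
point loses time at unit speed, so both routes are geodesic because `M_t` is 1-Lipschitz; uniqueness
of the geodesic gives `w = w'`. -/
theorem eq_of_descending {z w w' : ζ.carrier} (h : dist z w = ζ.time z - ζ.time w)
    (h' : dist z w' = ζ.time z - ζ.time w') (ht : ζ.time w = ζ.time w') : w = w' := by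
  obtain ⟨p, hp, hp1, hp2⟩ := ζ.exists_lowest w w'
  have h1 := abs_le.1 (ζ.abs_time_sub_le z p)
  have h2 := dist_triangle z w p
  refine ζ.isRealTree.eq_of_dist_add (z := z) (w := p) ?_ ?_ ?_ <;> linarith

theorem exists_descending (z : ζ.carrier) (u : ℝ≥0) :
    ∃ w, dist z w = u ∧ ζ.time w = ζ.time z - u := by
  -- On the way to a point at time `M_t(z) - u`, the first term of the maximum dominates at least up
  -- to distance `u`.
  obtain ⟨x, hx, -⟩ := ζ.isCharacteristic.spread (ζ.time z - u) 0
  have h1 := abs_le.1 (ζ.abs_time_sub_le z x)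
  obtain ⟨w, hw1, hw2⟩ := ζ.isRealTree.exists_between z x u ⟨u.2, by linarith⟩
  refine ⟨w, hw1, ?_⟩
  rw [ζ.time_of_dist_add (z := z) (v := w) (w := x) (by linarith), hw1, hw2, hx]
  exact max_eq_left (by linarith)

/-- The point at distance `u` below `z`. -/
noncomputable def descend (z : ζ.carrier) (u : ℝ≥0) : ζ.carrier := (ζ.exists_descending z u).choose

theorem dist_descend (z : ζ.carrier) (u : ℝ≥0) : dist z (ζ.descend z u) = u :=
  (ζ.exists_descending z u).choose_spec.1

theorem time_descend (z : ζ.carrier) (u : ℝ≥0) : ζ.time (ζ.descend z u) = ζ.time z - u :=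
  (ζ.exists_descending z u).choose_spec.2

theorem eq_descend {z w : ζ.carrier} {u : ℝ≥0} (h1 : dist z w = u)
    (h2 : ζ.time w = ζ.time z - u) : w = ζ.descend z u := by
  refine ζ.eq_of_descending (z := z) ?_ ?_ ?_
  · linarith
  · linarith [ζ.dist_descend z u, ζ.time_descend z u]
  · linarith [ζ.time_descend z u]

theorem descend_descend (z : ζ.carrier) (u v : ℝ≥0) :
    ζ.descend (ζ.descend z u) v = ζ.descend z (u + v) := by
  have h1 := ζ.dist_descend z u
  have h2 := ζ.dist_descend (ζ.descend z u) v
  have h3 := ζ.time_descend z u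
  have h4 := ζ.time_descend (ζ.descend z u) v
  have h5 := dist_triangle z (ζ.descend z u) (ζ.descend (ζ.descend z u) v)
  have h6 := abs_le.1 (ζ.abs_time_sub_le z (ζ.descend (ζ.descend z u) v))
  apply ζ.eq_descend <;> push_cast
  · apply le_antisymm <;> linarith
  · linarith

/-- The end `†` of a characteristic tree. -/
noncomputable def rootEnd : UnboundedEnd ζ.carrier where
  ray := ζ.descend
  isometry_ray z := by
    have key : ∀ u v : ℝ≥0, u ≤ v → dist (ζ.descend z u) (ζ.descend z v) = dist u v := by
      intro u v huv
      rw [← add_tsub_cancel_of_le huv, ← ζ.descend_descend, ζ.dist_descend, NNReal.dist_eq,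
        NNReal.coe_add, sub_add_cancel_left, abs_neg, NNReal.abs_eq]
    refine Isometry.of_dist_eq fun u v => ?_
    rcases le_total u v with h | h
    · exact key u v h
    · rw [dist_comm, key v u h, dist_comm]
  ray_zero z := (dist_eq_zero.1 (by rw [ζ.dist_descend, NNReal.coe_zero])).symm
  equiv z w := by
    obtain ⟨m, -, h1, h2⟩ := ζ.exists_lowest z w
    have ha : m = ζ.descend z (nndist z m) :=
      ζ.eq_descend (coe_nndist z m).symm (by rw [coe_nndist]; linarith)
    have hb : m = ζ.descend w (nndist w m) :=
      ζ.eq_descend (coe_nndist w m).symm (by rw [coe_nndist]; linarith)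
    refine ⟨nndist z m, nndist w m, fun u => ?_⟩
    rw [← ζ.descend_descend, ← ζ.descend_descend, ← ha, ← hb]

theorem isRoot_rootEnd : ζ.IsRoot ζ.rootEnd := ζ.time_descend

theorem ray_eq_descend {e : UnboundedEnd ζ.carrier} (he : ζ.IsRoot e) (z : ζ.carrier) (u : ℝ≥0) :
    e.ray z u = ζ.descend z u := by
  refine ζ.eq_descend ?_ (he z u)
  have h := (e.isometry_ray z).dist_eq 0 u
  rwa [e.ray_zero, NNReal.dist_eq, NNReal.coe_zero, zero_sub, abs_neg, NNReal.abs_eq] at h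

/-- The point of the ray from `z` at time `s` (or `z` itself if `z` is below time `s`). -/
noncomputable abbrev below (z : ζ.carrier) (s : ℝ) : ζ.carrier := ζ.radial ζ.rootEnd z s

/-- The path traced by the ray from `z`. -/
noncomputable abbrev path (z : ζ.carrier) : BackwardPath := ζ.radialPath ζ.rootEnd z

theorem pathSet_eq_range : ζ.pathSet = range ζ.path := by
  ext π
  constructor
  · rintro ⟨e, he, z, rfl⟩
    refine ⟨z, BackwardPath.ext rfl (funext fun s => ?_)⟩
    simp only [radialPath, radial, ζ.ray_eq_descend he]
    rfl
  · rintro ⟨z, rfl⟩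
    exact ⟨ζ.rootEnd, ζ.isRoot_rootEnd, z, rfl⟩

theorem time_below (z : ζ.carrier) (s : ℝ) : ζ.time (ζ.below z s) = min (ζ.time z) s := by
  rw [below, radial, ζ.isRoot_rootEnd, Real.coe_toNNReal']
  rcases le_total (ζ.time z) s with h | h
  · rw [min_eq_left h, max_eq_right (by linarith), sub_zero]
  · rw [min_eq_right h, max_eq_left (by linarith)]; ring

theorem dist_below (z : ζ.carrier) (s : ℝ) : dist z (ζ.below z s) = max (ζ.time z - s) 0 :=
  (ζ.dist_descend z _).trans (Real.coe_toNNReal' _)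

theorem below_of_le {z : ζ.carrier} {s : ℝ} (h : ζ.time z ≤ s) : ζ.below z s = z := by
  rw [below, radial, Real.toNNReal_of_nonpos (by linarith), ζ.rootEnd.ray_zero]

theorem dist_below_below (z : ζ.carrier) (s t : ℝ) :
    dist (ζ.below z s) (ζ.below z t) = |min (ζ.time z) s - min (ζ.time z) t| := by
  rw [below, below, radial, radial, (ζ.rootEnd.isometry_ray z).dist_eq, NNReal.dist_eq,
    Real.coe_toNNReal', Real.coe_toNNReal', abs_sub_comm]
  congr 1
  have : ∀ a b : ℝ, max (a - b) 0 = a - min a b := fun a b => by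
    rcases le_total a b with h | h
    · rw [min_eq_left h, max_eq_right (by linarith), sub_self]
    · rw [min_eq_right h, max_eq_left (by linarith)]
  rw [this, this]
  ring

theorem eq_below {z w : ζ.carrier} (h : dist z w = ζ.time z - ζ.time w) :
    w = ζ.below z (ζ.time w) := by
  have h0 : 0 ≤ ζ.time z - ζ.time w := h ▸ dist_nonneg
  refine ζ.eq_descend ?_ ?_ <;> rw [Real.coe_toNNReal _ h0]
  · exact h
  · ring

theorem below_below (z : ζ.carrier) {s t : ℝ} (h : t ≤ s) :
    ζ.below (ζ.below z s) t = ζ.below z t := by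
  have h1 := ζ.time_below z s
  refine (ζ.descend_descend z _ _).trans (congrArg (ζ.descend z) (NNReal.eq ?_))
  rw [NNReal.coe_add, Real.coe_toNNReal', Real.coe_toNNReal', Real.coe_toNNReal', h1]
  rcases le_total (ζ.time z) s with h2 | h2
  · rw [min_eq_left h2, max_eq_right (by linarith), zero_add]
  · rw [min_eq_right h2, max_eq_left (by linarith), max_eq_left (by linarith),
      max_eq_left (by linarith)]
    ring

theorem isCompact_closedBall (z : ζ.carrier) (r : ℝ) : IsCompact (Metric.closedBall z r) := by
  have := ζ.complete
  have := ζ.locallyCompact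
  exact isCompact_closedBall_of_geodesic ζ.isRealTree.exists_between z r

theorem continuous_space : Continuous ζ.space :=
  (EuclideanSpace.proj (𝕜 := ℝ) (1 : Fin 2)).continuous.comp ζ.proper.continuous

theorem continuous_below (z : ζ.carrier) : Continuous (ζ.below z) :=
  (ζ.rootEnd.isometry_ray z).continuous.comp
    (continuous_real_toNNReal.comp (continuous_const.sub continuous_id))

end CharTree

/-! ### The properness map -/

namespace SpatialTree

variable {α : ℝ} (ζ : SpatialTree α)

theorem norm_eval_le (z : ζ.carrier) : ‖ζ.eval z‖ ≤ |ζ.time z| + |ζ.space z| := by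
  rw [EuclideanSpace.norm_eq, Fin.sum_univ_two]
  refine Real.sqrt_le_iff.2 ⟨by positivity, ?_⟩
  simp only [Real.norm_eq_abs, time, space]
  nlinarith [abs_nonneg (ζ.eval z 0), abs_nonneg (ζ.eval z 1)]

theorem bddAbove_properness (r : ℝ) :
    BddAbove {x | ∃ z : ζ.carrier, |ζ.time z| ≤ r ∧ |ζ.space z| ≤ r ∧ x = dist ζ.base z} := by
  have hc : IsCompact (ζ.eval ⁻¹' Metric.closedBall 0 (2 * r)) :=
    ζ.proper.isCompact_preimage (isCompact_closedBall _ _)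
  obtain ⟨b, hb⟩ := (hc.isBounded.subset_closedBall ζ.base)
  refine ⟨b, ?_⟩
  rintro _ ⟨z, h1, h2, rfl⟩
  rw [dist_comm]
  refine hb ?_
  rw [mem_preimage, mem_closedBall_zero_iff]
  linarith [ζ.norm_eval_le z]

theorem dist_le_properness {r : ℝ} {z : ζ.carrier} (h1 : |ζ.time z| ≤ r) (h2 : |ζ.space z| ≤ r) :
    dist ζ.base z ≤ ζ.properness r := by
  rw [properness, if_neg (not_lt.2 ((abs_nonneg _).trans h1))]
  exact le_csSup (ζ.bddAbove_properness r) ⟨z, h1, h2, rfl⟩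

theorem properness_nonneg (r : ℝ) : 0 ≤ ζ.properness r := by
  rw [properness]
  split_ifs
  · exact le_rfl
  · refine Real.sSup_nonneg ?_
    rintro _ ⟨z, -, -, rfl⟩
    exact dist_nonneg

theorem monotone_properness : Monotone ζ.properness := by
  intro a b hab
  rw [properness]
  split_ifs with h
  · exact ζ.properness_nonneg b
  · refine Real.sSup_le ?_ (ζ.properness_nonneg b)
    rintro _ ⟨z, h1, h2, rfl⟩
    exact ζ.dist_le_properness (h1.trans hab) (h2.trans hab)

end SpatialTree

/-! ### Distances of the paths traced by rays -/

theorem abs_div_sub_div_le {a b p q : ℝ} (ha : |a| ≤ 1) :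
    |a / (1 + |p|) - b / (1 + |q|)| ≤ |a - b| + |p - q| := by
  have hp : 0 < 1 + |p| := by positivity
  have hq : 0 < 1 + |q| := by positivity
  have h1 : a / (1 + |p|) - b / (1 + |q|) =
      (a - b) / (1 + |q|) + a * (|q| - |p|) / ((1 + |p|) * (1 + |q|)) := by
    field_simp; ring
  rw [h1]
  refine (abs_add_le _ _).trans (add_le_add ?_ ?_)
  · rw [abs_div, abs_of_pos hq]
    exact div_le_self (abs_nonneg _) (by linarith [abs_nonneg q])
  · rw [abs_div, abs_mul, abs_of_pos (mul_pos hp hq)]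
    refine (div_le_self (by positivity) ?_).trans ?_
    · nlinarith [abs_nonneg p, abs_nonneg q]
    · refine (mul_le_of_le_one_left (abs_nonneg _) ha).trans ?_
      rw [abs_sub_comm p q]
      exact abs_abs_sub_abs_le_abs_sub _ _

namespace CharTree

open BackwardPath

variable {α : ℝ} (ζ ζ' : CharTree α)

theorem stopped_path (z : ζ.carrier) (t : ℝ) : (ζ.path z).stopped t = min t (ζ.time z) := by
  change (min (t : EReal) (ζ.time z : EReal)).toReal = _
  rw [← EReal.coe_strictMono.monotone.map_min, EReal.toReal_coe]

theorem coord_path (z : ζ.carrier) (t : ℝ) :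
    (ζ.path z).coord t = Real.tanh (ζ.space (ζ.below z t)) / (1 + |min t (ζ.time z)|) := by
  have h := toFun_stopped (ζ.path z) (EReal.coe_ne_bot _) t
  rw [coord, h, stopped_path]
  rfl

theorem abs_coord_path_le {z : ζ.carrier} {t R : ℝ} (hR : 0 ≤ R) (h : R ≤ |min t (ζ.time z)|) :
    |(ζ.path z).coord t| ≤ 1 / (1 + R) := by
  refine (abs_coord_le_one_div _ _).trans ?_
  rw [stopped_path]
  gcongr

theorem abs_coord_path_sub_le {z : ζ.carrier} {z' : ζ'.carrier} {t R : ℝ} (hR : 0 ≤ R)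
    (h : R ≤ |min t (ζ.time z)|) (h' : R ≤ |min t (ζ'.time z')|) :
    |(ζ.path z).coord t - (ζ'.path z').coord t| ≤ 2 / (1 + R) := by
  have h1 := abs_sub ((ζ.path z).coord t) ((ζ'.path z').coord t)
  have h2 := ζ.abs_coord_path_le hR h
  have h3 := ζ'.abs_coord_path_le hR h'
  have h4 : 2 / (1 + R) = 1 / (1 + R) + 1 / (1 + R) := by ring
  linarith

/-- Positions matter only at times `s ≥ -R`: earlier, both coordinates are at most `1 / (1 + R)`. -/
theorem dist_path_le {z : ζ.carrier} {z' : ζ'.carrier} {R δ ε : ℝ} (hR : 0 ≤ R) (hε : 0 ≤ ε)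
    (ht : |ζ.time z - ζ'.time z'| ≤ δ)
    (hx : ∀ s, -R ≤ s →
      |Real.tanh (ζ.space (ζ.below z s)) - Real.tanh (ζ'.space (ζ'.below z' s))| ≤ ε) :
    dist (ζ.path z) (ζ'.path z') ≤ ε + δ + 2 / (1 + R) := by
  have hδ : 0 ≤ δ := (abs_nonneg _).trans ht
  have hR' : 0 ≤ 2 / (1 + R) := by positivity
  refine dist_le_iff.2 ⟨?_, fun t => ?_⟩
  · have := abs_tanh_sub_tanh_le (ζ.time z) (ζ'.time z')
    change |Real.tanh (ζ.time z) - Real.tanh (ζ'.time z')| ≤ _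
    linarith
  · rcases le_or_gt (-R) t with h | h
    · rw [coord_path, coord_path]
      refine (abs_div_sub_div_le (Real.abs_tanh_lt_one _).le).trans ?_
      have h1 := hx t h
      have h2 : |min t (ζ.time z) - min t (ζ'.time z')| ≤ |ζ.time z - ζ'.time z'| := by
        simpa using abs_min_sub_min_le_max t (ζ.time z) t (ζ'.time z')
      linarith
    · refine (ζ.abs_coord_path_sub_le ζ' hR ?_ ?_).trans (by linarith)
      · linarith [neg_le_abs (min t (ζ.time z)), min_le_left t (ζ.time z)]
      · linarith [neg_le_abs (min t (ζ'.time z')), min_le_left t (ζ'.time z')]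

theorem dist_path_le_of_time_le {z : ζ.carrier} {z' : ζ'.carrier} {R : ℝ} (hR : 0 ≤ R)
    (h : ζ.time z ≤ -R) (h' : ζ'.time z' ≤ -R) :
    dist (ζ.path z) (ζ'.path z') ≤ 2 / (1 + R) := by
  refine dist_le_iff.2 ⟨?_, fun t => ζ.abs_coord_path_sub_le ζ' hR ?_ ?_⟩
  · refine (abs_tanh_sub_tanh_le_of_le_neg hR h h').trans ?_
    gcongr
    norm_num
  · linarith [neg_le_abs (min t (ζ.time z)), min_le_right t (ζ.time z)]
  · linarith [neg_le_abs (min t (ζ'.time z')), min_le_right t (ζ'.time z')]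

/-- Truncation at time `R`: the coordinates agree up to `R`, and after it both are at most `1 / (1 +
R)`. -/
theorem dist_path_path_below_le {z : ζ.carrier} {R : ℝ} (hR : 0 ≤ R) (h : R ≤ ζ.time z) :
    dist (ζ.path z) (ζ.path (ζ.below z R)) ≤ 2 / (1 + R) := by
  have ht : ζ.time (ζ.below z R) = R := by rw [time_below, min_eq_right h]
  refine dist_le_iff.2 ⟨?_, fun t => ?_⟩
  · change |Real.tanh (ζ.time z) - Real.tanh (ζ.time (ζ.below z R))| ≤ _
    refine (abs_tanh_sub_tanh_le_of_le hR h ht.ge).trans ?_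
    gcongr
    norm_num
  · rcases le_total t R with htR | htR
    · rw [coord_path, coord_path, below_below _ _ htR, ht, min_eq_left htR,
        min_eq_left (htR.trans h), sub_self, abs_zero]
      positivity
    · refine ζ.abs_coord_path_sub_le ζ hR ?_ ?_
      · exact (le_min htR h).trans (le_abs_self _)
      · rw [ht]
        exact (le_min htR le_rfl).trans (le_abs_self _)

/-- The ray meets the box `[-R, R]²` at most `2R` below `z`, and `b_ζ(R)` bounds the distance of the
base point to the box. -/
theorem dist_base_le_of_abs_space_le {z : ζ.carrier} {R s : ℝ} (h1 : -R ≤ ζ.time z)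
    (h2 : ζ.time z ≤ R) (hs : -R ≤ s) (hx : |ζ.space (ζ.below z s)| ≤ R) :
    dist ζ.base z ≤ ζ.properness R + 2 * R := by
  have h3 : dist ζ.base (ζ.below z s) ≤ ζ.properness R := by
    refine ζ.dist_le_properness ?_ hx
    rw [time_below]
    exact abs_le.2 ⟨le_min h1 hs, (min_le_left _ _).trans h2⟩
  have h4 := ζ.dist_below z s
  have h5 : max (ζ.time z - s) 0 ≤ 2 * R := max_le (by linarith) (by linarith)
  linarith [dist_triangle ζ.base (ζ.below z s) z, dist_comm z (ζ.below z s)]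

/-- By the intermediate value theorem, a path avoiding `[-R, R]` stays on one side of it. -/
theorem space_below_of_abs_gt {z : ζ.carrier} {R : ℝ} (hR : 0 ≤ R)
    (h : ∀ s, -R ≤ s → R < |ζ.space (ζ.below z s)|) :
    (∀ s, -R ≤ s → R < ζ.space (ζ.below z s)) ∨ ∀ s, -R ≤ s → ζ.space (ζ.below z s) < -R := by
  have hc : Continuous fun s => ζ.space (ζ.below z s) :=
    ζ.continuous_space.comp (ζ.continuous_below z)
  by_contra! hcon
  obtain ⟨⟨a, ha, hxa⟩, ⟨b, hb, hxb⟩⟩ := hcon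
  have hxb' : R < ζ.space (ζ.below z b) := by
    rcases lt_abs.1 (h b hb) with h' | h' <;> linarith
  obtain ⟨s, hs, hxs⟩ := isPreconnected_Ici.intermediate_value ha hb hc.continuousOn ⟨hxa, hxb'.le⟩
  have := h s hs
  simp only at hxs
  rw [hxs, abs_of_nonneg hR] at this
  exact lt_irrefl _ this

/-- Every path of an arbitrary tree is close to a path of `ζ` that starts in a fixed ball, or to
one that starts in a ball around the base point whose radius is given by the properness map. -/
theorem exists_radius_forall_path_near {R : ℝ} (hR : 0 ≤ R) : ∃ r, ∀ (ζ' : CharTree α) (z' : ζ'.carrier),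
    (∃ w : ζ.carrier, dist ζ.base w ≤ r ∧ dist (ζ'.path z') (ζ.path w) ≤ 5 / (1 + R)) ∨
    ∃ w' : ζ'.carrier, dist ζ'.base w' ≤ ζ'.properness R + 2 * R ∧
      dist (ζ'.path z') (ζ'.path w') ≤ 2 / (1 + R) := by
  obtain ⟨B, hB⟩ := ((ζ.isCompact_closedBall ζ.base (ζ.properness R + 2 * R)).image
    ζ.continuous_space).isBounded.exists_norm_le
  replace hB : ∀ w, dist ζ.base w ≤ ζ.properness R + 2 * R → |ζ.space w| ≤ B := fun w hw =>
    hB _ ⟨w, by rwa [Metric.mem_closedBall, dist_comm], rfl⟩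
  obtain ⟨w₀, hw₀, -⟩ := ζ.isCharacteristic.spread (-R) 0
  let B' := max B R
  have hBB : B ≤ B' := le_max_left _ _
  have hRB : R ≤ B' := le_max_right _ _
  have hc : 0 ≤ 1 / (1 + R) := by positivity
  have h2c : 2 / (1 + R) = 2 * (1 / (1 + R)) := by ring
  have h5c : 5 / (1 + R) = 5 * (1 / (1 + R)) := by ring
  -- A ray entering the box starts in the ball on which `|M_x| ≤ B`; a start beyond `B'` therefore
  -- rules this out.
  have hfar : ∀ w : ζ.carrier, -R ≤ ζ.time w → ζ.time w ≤ R → B' < |ζ.space w| →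
      (∀ s, -R ≤ s → R < |ζ.space (ζ.below w s)|) := by
    intro w h1 h2 hw s hs
    by_contra! hcon
    exact absurd (hB w (ζ.dist_base_le_of_abs_space_le h1 h2 hs hcon)) (not_le.2 (hBB.trans_lt hw))
  have key : ∀ (ζ' : CharTree α) (z' : ζ'.carrier), ζ'.time z' ≤ R →
      (∃ w : ζ.carrier, dist ζ.base w ≤ max (dist ζ.base w₀) (ζ.properness (B' + 3)) ∧
        dist (ζ'.path z') (ζ.path w) ≤ 3 / (1 + R)) ∨
      dist ζ'.base z' ≤ ζ'.properness R + 2 * R := by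
    intro ζ' z' hz'
    have h3c : 3 / (1 + R) = 3 * (1 / (1 + R)) := by ring
    rcases le_total (ζ'.time z') (-R) with h | h
    · refine Or.inl ⟨w₀, le_max_left _ _, ?_⟩
      have := ζ'.dist_path_le_of_time_le ζ hR h hw₀.le
      linarith
    by_cases hbox : ∃ s, -R ≤ s ∧ |ζ'.space (ζ'.below z' s)| ≤ R
    · obtain ⟨s, hs, hx⟩ := hbox
      exact Or.inr (ζ'.dist_base_le_of_abs_space_le h hz' hs hx)
    push Not at hbox
    left
    have hnear : ∀ w : ζ.carrier, ζ.time w = ζ'.time z' → |ζ.space w| ≤ B' + 3 →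
        (∀ s, -R ≤ s → |Real.tanh (ζ'.space (ζ'.below z' s)) -
          Real.tanh (ζ.space (ζ.below w s))| ≤ 1 / (1 + R)) →
        ∃ w : ζ.carrier, dist ζ.base w ≤ max (dist ζ.base w₀) (ζ.properness (B' + 3)) ∧
          dist (ζ'.path z') (ζ.path w) ≤ 3 / (1 + R) := by
      intro w hw hx hs
      refine ⟨w, le_max_of_le_right (ζ.dist_le_properness ?_ hx), ?_⟩
      · rw [hw]; exact abs_le.2 ⟨by linarith, by linarith⟩
      · have := ζ'.dist_path_le ζ (z := z') (z' := w) (δ := 0) hR hc (by rw [hw]; simp) hs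
        linarith
    rcases ζ'.space_below_of_abs_gt hR hbox with hup | hdown
    · obtain ⟨w, hw, hx1, hx2⟩ := ζ.isCharacteristic.spread (ζ'.time z') (B' + 2)
      have h0 : 0 ≤ ζ.space w := by linarith
      have hfw := hfar w (hw ▸ h) (hw ▸ hz') (by rw [abs_of_nonneg h0]; linarith)
      refine hnear w hw (by rw [abs_of_nonneg h0]; linarith) fun s hs => ?_
      rcases ζ.space_below_of_abs_gt hR hfw with hw' | hw'
      · exact abs_tanh_sub_tanh_le_of_le hR (hup s hs).le (hw' s hs).le
      · have := hw' (ζ.time w) (hw ▸ h)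
        rw [below_of_le _ le_rfl] at this
        linarith
    · obtain ⟨w, hw, hx1, hx2⟩ := ζ.isCharacteristic.spread (ζ'.time z') (-(B' + 2))
      have h0 : ζ.space w ≤ 0 := by linarith
      have hfw := hfar w (hw ▸ h) (hw ▸ hz') (by rw [abs_of_nonpos h0]; linarith)
      refine hnear w hw (by rw [abs_of_nonpos h0]; linarith) fun s hs => ?_
      rcases ζ.space_below_of_abs_gt hR hfw with hw' | hw'
      · have := hw' (ζ.time w) (hw ▸ h)
        rw [below_of_le _ le_rfl] at this
        linarith
      · exact abs_tanh_sub_tanh_le_of_le_neg hR (hdown s hs).le (hw' s hs).le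
  refine ⟨max (dist ζ.base w₀) (ζ.properness (B' + 3)), fun ζ' z' => ?_⟩
  -- Truncation costs `2 / (1 + R)` and `key` costs `3 / (1 + R)`, which gives the constant 5.
  have hcut : ∃ y : ζ'.carrier, ζ'.time y ≤ R ∧ dist (ζ'.path z') (ζ'.path y) ≤ 2 / (1 + R) := by
    rcases le_total (ζ'.time z') R with h | h
    · exact ⟨z', h, by rw [dist_self]; linarith⟩
    · exact ⟨ζ'.below z' R, by rw [time_below]; exact min_le_right _ _,
        ζ'.dist_path_path_below_le hR h⟩
  obtain ⟨y, hy, hd⟩ := hcut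
  refine (key ζ' y hy).imp ?_ fun h => ⟨y, h, hd⟩
  rintro ⟨w, hw, hdw⟩
  refine ⟨w, hw, (dist_triangle _ _ _).trans ((add_le_add hd hdw).trans_eq ?_)⟩
  ring

/-- Paths that start at corresponding points are close, for a relation `C` with small distortion
and almost preserving the evaluation maps. -/
theorem dist_path_le_of_relation {C : Set (ζ.carrier × ζ'.carrier)} {R δ ε : ℝ} (hR : 0 ≤ R)
    (hε : 0 ≤ ε) (hdist : ∀ p ∈ C, ∀ q ∈ C, |dist p.1 q.1 - dist p.2 q.2| ≤ 2 * δ)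
    (htime : ∀ p ∈ C, |ζ.time p.1 - ζ'.time p.2| ≤ δ)
    (hspace : ∀ p ∈ C, |ζ.space p.1 - ζ'.space p.2| ≤ ε)
    (hmod : ∀ p ∈ C, ∀ q ∈ C, dist p.1 q.1 ≤ 8 * δ → |ζ.space p.1 - ζ.space q.1| ≤ ε)
    {z : ζ.carrier} {z' : ζ'.carrier} (hz : (z, z') ∈ C)
    (hfst : ∀ s, -R ≤ s → ∃ q, (ζ.below z s, q) ∈ C)
    (hsnd : ∀ s, -R ≤ s → ∃ p, (p, ζ'.below z' s) ∈ C) :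
    dist (ζ.path z) (ζ'.path z') ≤ 2 * ε + δ + 2 / (1 + R) := by
  refine ζ.dist_path_le ζ' hR (by positivity) (htime _ hz) fun s hs => ?_
  obtain ⟨q, hq⟩ := hfst s hs
  obtain ⟨p, hp⟩ := hsnd s hs
  have ht := abs_le.1 (htime _ hz)
  have htq := abs_le.1 (htime _ hq)
  have hdq := abs_le.1 (hdist _ hz _ hq)
  simp only [time_below, dist_below] at ht htq hdq
  -- The partner `q` of `ρ(z, s)` need not lie on the ray from `z'`. The point `m` where the two
  -- rays merge is within `2δ` of `q` and within `4δ` of `ρ(z', s)`; passing back through the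
  -- correspondence adds `2δ`, whence the `8δ` in `hmod`.
  obtain ⟨m, hm, hm1, hm2⟩ := ζ'.exists_lowest z' q
  have hbelow : dist m (ζ'.below z' s) = |ζ'.time m - min (ζ'.time z') s| := by
    conv_lhs => rw [ζ'.eq_below hm1]
    have h0 : 0 ≤ ζ'.time z' - ζ'.time m := hm1 ▸ dist_nonneg
    rw [dist_below_below, min_eq_right (by linarith)]
  have hmin : max (ζ.time z - s) 0 = ζ.time z - min (ζ.time z) s := by
    rcases le_total (ζ.time z) s with h | h
    · rw [min_eq_left h, max_eq_right (by linarith), sub_self]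
    · rw [min_eq_right h, max_eq_left (by linarith)]
  have hmm := abs_le.1 (abs_min_sub_min_le_max (ζ.time z) s (ζ'.time z') s)
  have hmax : max |ζ.time z - ζ'.time z'| |s - s| ≤ δ := by
    rw [sub_self, abs_zero]
    exact max_le (abs_le.2 ht) ((abs_nonneg _).trans (abs_le.2 ht))
  have hqb : dist q (ζ'.below z' s) ≤ 6 * δ := by
    have h1 : dist q m ≤ 2 * δ := by linarith
    have h2 : dist m (ζ'.below z' s) ≤ 4 * δ := by
      rw [hbelow, abs_le]
      constructor <;> linarith [dist_nonneg (x := q) (y := m)]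
    linarith [dist_triangle q m (ζ'.below z' s)]
  have hpq := abs_le.1 (hdist _ hq _ hp)
  have h1 := hmod _ hq _ hp (by simp only at hpq ⊢; linarith)
  have h2 := hspace _ hp
  refine (abs_tanh_sub_tanh_le _ _).trans ?_
  have h3 := abs_sub_le (ζ.space (ζ.below z s)) (ζ.space p) (ζ'.space (ζ'.below z' s))
  simp only at h1 h2
  linarith

end CharTree

/-! ### Compactness of the set of paths -/

theorem exists_five_div_one_add_le {η : ℝ} (hη : 0 < η) : ∃ R : ℝ, 0 ≤ R ∧ 5 / (1 + R) ≤ η := by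
  refine ⟨5 / η, by positivity, ?_⟩
  rw [div_le_iff₀ (by positivity), mul_add, mul_div_cancel₀ _ hη.ne']
  linarith

namespace CharTree

variable {α : ℝ} (ζ ζ' : CharTree α)

theorem exists_space_modulus (r : ℝ) {ε : ℝ} (hε : 0 < ε) :
    ∃ δ, 0 < δ ∧ δ ≤ 1 ∧ δ ≤ ε ∧ ∀ p q, dist ζ.base p ≤ r → dist ζ.base q ≤ r →
      dist p q ≤ 8 * δ → |ζ.space p - ζ.space q| ≤ ε := by
  have huc := (ζ.isCompact_closedBall ζ.base r).uniformContinuousOn_of_continuous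
    ζ.continuous_space.continuousOn
  obtain ⟨δ₀, hδ₀, h⟩ := Metric.uniformContinuousOn_iff.1 huc ε hε
  refine ⟨min (δ₀ / 16) (min 1 ε), by positivity, (min_le_right _ _).trans (min_le_left _ _),
    (min_le_right _ _).trans (min_le_right _ _), fun p q hp hq hpq => ?_⟩
  refine (h p ?_ q ?_ ?_).le
  · rwa [Metric.mem_closedBall, dist_comm]
  · rwa [Metric.mem_closedBall, dist_comm]
  · linarith [min_le_left (δ₀ / 16) (min 1 ε)]

theorem dist_base_below_le {z : ζ.carrier} {ρ R s : ℝ} (hR : 0 ≤ R) (hz : dist ζ.base z ≤ ρ)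
    (hs : -R ≤ s) : dist ζ.base (ζ.below z s) ≤ 2 * ρ + |ζ.time ζ.base| + R := by
  have h1 := ζ.dist_below z s
  have h2 := abs_le.1 (ζ.abs_time_sub_le ζ.base z)
  have h3 := le_abs_self (ζ.time ζ.base)
  have h4 : max (ζ.time z - s) 0 ≤ ρ + |ζ.time ζ.base| + R :=
    max_le (by linarith) (by linarith [abs_nonneg (ζ.time ζ.base), dist_nonneg.trans hz])
  linarith [dist_triangle ζ.base z (ζ.below z s)]

/-- The relation estimate within a single tree, for the relation of being at distance at most `δ`
inside a large ball. -/
theorem continuous_path : Continuous ζ.path := by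
  rw [Metric.continuous_iff]
  intro z η hη
  obtain ⟨R, hR, hRη⟩ := exists_five_div_one_add_le (half_pos hη)
  let ρ := dist ζ.base z + 1
  let r := 2 * ρ + |ζ.time ζ.base| + R
  obtain ⟨δ, hδ, hδ1, hδε, hmod⟩ := ζ.exists_space_modulus r (ε := η / 8) (by positivity)
  refine ⟨δ, hδ, fun w hw => ?_⟩
  let C : Set (ζ.carrier × ζ.carrier) :=
    {p | dist ζ.base p.1 ≤ r ∧ dist ζ.base p.2 ≤ r ∧ dist p.1 p.2 ≤ δ}
  have hbase : ∀ y, dist y z ≤ δ → ∀ s, -R ≤ s → dist ζ.base (ζ.below y s) ≤ r := fun y hy s hs =>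
    ζ.dist_base_below_le hR
      (by linarith [dist_triangle ζ.base z y, dist_comm y z, show ρ = dist ζ.base z + 1 from rfl]) hs
  have hself : ∀ y, dist y z ≤ δ → dist ζ.base y ≤ r := fun y hy => by
    -- At a time `s ≥ M_t(y)` the point `ρ(y, s)` is `y` itself.
    have h := hbase y hy (max (-R) (ζ.time y)) (le_max_left _ _)
    rwa [below_of_le _ (le_max_right _ _)] at h
  have hz : dist z z ≤ δ := by rw [dist_self]; exact hδ.le
  have key := ζ.dist_path_le_of_relation ζ (C := C) (R := R) (δ := δ) (ε := η / 8) hR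
    (by positivity)
    (fun p hp q hq => by
      have h1 := hp.2.2
      have h2 := hq.2.2
      rw [abs_le]
      constructor
      · linarith [dist_triangle4 p.2 p.1 q.1 q.2, dist_comm p.1 p.2]
      · linarith [dist_triangle4 p.1 p.2 q.2 q.1, dist_comm q.1 q.2])
    (fun p hp => (ζ.abs_time_sub_le _ _).trans hp.2.2)
    (fun p hp => hmod _ _ hp.1 hp.2.1 (hp.2.2.trans (by linarith)))
    (fun p hp q hq h => hmod _ _ hp.1 hq.1 h)
    (z := w) (z' := z) ⟨hself w hw.le, hself z hz, hw.le⟩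
    (fun s hs => ⟨ζ.below w s, hbase w hw.le s hs, hbase w hw.le s hs, by rw [dist_self]; exact hδ.le⟩)
    (fun s hs => ⟨ζ.below z s, hbase z hz s hs, hbase z hz s hs, by rw [dist_self]; exact hδ.le⟩)
  have h2 : 2 / (1 + R) = 2 / 5 * (5 / (1 + R)) := by ring
  linarith

/-- With `ζ' = ζ` both alternatives of `exists_radius_forall_path_near` provide a starting point in
a fixed ball of `ζ`. -/
theorem exists_ball_path_near {η : ℝ} (hη : 0 < η) : ∃ r, ∀ z : ζ.carrier,
    ∃ w : ζ.carrier, dist ζ.base w ≤ r ∧ dist (ζ.path z) (ζ.path w) ≤ η := by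
  obtain ⟨R, hR, hRη⟩ := exists_five_div_one_add_le hη
  obtain ⟨r, hr⟩ := ζ.exists_radius_forall_path_near hR
  have h2 : 2 / (1 + R) = 2 / 5 * (5 / (1 + R)) := by ring
  refine ⟨max r (ζ.properness R + 2 * R), fun z => ?_⟩
  rcases hr ζ z with ⟨w, hw, hd⟩ | ⟨w, hw, hd⟩
  · exact ⟨w, le_max_of_le_left hw, hd.trans hRη⟩
  · exact ⟨w, le_max_of_le_right hw, by linarith⟩

theorem isCompact_closure_pathSet : IsCompact (closure ζ.pathSet) := by
  rw [isCompact_iff_totallyBounded_isComplete]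
  refine ⟨TotallyBounded.closure ?_, isClosed_closure.isComplete⟩
  rw [Metric.totallyBounded_iff]
  intro ε hε
  obtain ⟨r, hr⟩ := ζ.exists_ball_path_near (half_pos hε)
  obtain ⟨t, ht, hcov⟩ := Metric.totallyBounded_iff.1
    ((ζ.isCompact_closedBall ζ.base r).image ζ.continuous_path).totallyBounded (ε / 2) (half_pos hε)
  refine ⟨t, ht, ?_⟩
  rw [pathSet_eq_range]
  rintro _ ⟨z, rfl⟩
  obtain ⟨w, hw, hd⟩ := hr z
  obtain ⟨y, hy, hwy⟩ := mem_iUnion₂.1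
    (hcov ⟨w, by rwa [Metric.mem_closedBall, dist_comm], rfl⟩)
  refine mem_iUnion₂.2 ⟨y, hy, ?_⟩
  rw [Metric.mem_ball] at hwy ⊢
  linarith [dist_triangle (ζ.path z) (ζ.path w) y]

end CharTree

/-! ### Consequences of closeness in the distance of trees -/

/-- If `f ≥ c` on all of `(a, a + 1]`, that interval alone would contribute `e^{-(a+1)} c` to the
integral. -/
theorem exists_lt_of_lintegral_exp_lt {f : ℝ → ℝ≥0∞} {a : ℝ} {c : ℝ≥0∞} (ha : 0 ≤ a) (hc : c ≤ 1)
    (h : ∫⁻ t in Ioi (0 : ℝ), ENNReal.ofReal (Real.exp (-t)) * min 1 (f t) <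
      ENNReal.ofReal (Real.exp (-(a + 1))) * c) : ∃ t ∈ Ioc a (a + 1), f t < c := by
  by_contra! hcon
  refine absurd h (not_lt.2 ?_)
  calc ENNReal.ofReal (Real.exp (-(a + 1))) * c
      = ∫⁻ _ in Ioc a (a + 1), ENNReal.ofReal (Real.exp (-(a + 1))) * c := by simp
    _ ≤ ∫⁻ t in Ioc a (a + 1), ENNReal.ofReal (Real.exp (-t)) * min 1 (f t) := by
        refine MeasureTheory.setLIntegral_mono' measurableSet_Ioc fun t ht => ?_
        refine mul_le_mul' (ENNReal.ofReal_le_ofReal (Real.exp_le_exp.2 ?_)) (le_min hc (hcon t ht))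
        linarith [ht.2]
    _ ≤ _ := MeasureTheory.lintegral_mono_set fun t ht => ha.trans_lt ht.1

/-- The graph point `(R, g R)` is matched within distance 1 by a point of the completed graph of
`f`; its time is below `R + 1`, and by monotonicity its value is at most `f (R + 1)`. -/
theorem le_of_m1Dist_lt {f g : ℝ → ℝ} (hf : Monotone f) {R : ℝ} (hR : 0 ≤ R)
    (h : m1Dist f g < ENNReal.ofReal (Real.exp (-(R + 1)))) : g R ≤ f (R + 1) + 1 := by
  rw [m1Dist, ← mul_one (ENNReal.ofReal (Real.exp (-(R + 1))))] at h
  obtain ⟨t, ht, hlt⟩ := exists_lt_of_lintegral_exp_lt hR le_rfl h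
  simp only [m1DistUpTo, iInf_lt_iff] at hlt
  obtain ⟨γ, hγ, γ', hγ', hlt⟩ := hlt
  have hmem : ((R, g R) : ℝ × ℝ) ∈ completedGraph g t :=
    ⟨⟨by simp only; linarith, ht.1.le⟩, right_mem_uIcc⟩
  rw [← hγ'.2.1] at hmem
  obtain ⟨u, hu, hγu⟩ := hmem
  have hd : edist (γ u) (γ' u) < 1 := (le_iSup₂ (f := fun u _ => edist (γ u) (γ' u)) u hu).trans_lt hlt
  rw [hγu, edist_dist, ← ENNReal.ofReal_one, ENNReal.ofReal_lt_ofReal_iff one_pos, Prod.dist_eq,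
    max_lt_iff, Real.dist_eq, Real.dist_eq, abs_lt, abs_lt] at hd
  have hmem' : γ u ∈ completedGraph f t := hγ.2.1 ▸ mem_image_of_mem γ hu
  have h1 : (γ u).2 ≤ f (γ u).1 := by
    have := hmem'.2.2
    rwa [sup_of_le_right (hf.leftLim_le le_rfl)] at this
  have h2 : f (γ u).1 ≤ f (R + 1) := hf (by linarith [hd.1.2])
  linarith [hd.2.1]

namespace SpatialTree

variable {α : ℝ} {ζ ζ' : SpatialTree α}

/-- Each term of the cost is below `δ`; the distortion enters halved, hence `2 * δ`. -/
theorem exists_correspondence_of_ballDist_lt {r δ : ℝ} (hδ : 0 ≤ δ)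
    (h : ballDist ζ ζ' r < ENNReal.ofReal δ) : ∃ C, IsCorrespondence ζ ζ' r C ∧
      (∀ p ∈ C, ∀ q ∈ C, |dist p.1 q.1 - dist p.2 q.2| ≤ 2 * δ) ∧
      ∀ p ∈ C, ‖ζ.eval p.1 - ζ'.eval p.2‖ ≤ δ := by
  simp only [ballDist, iInf_lt_iff] at h
  obtain ⟨C, hC, h⟩ := h
  rw [correspondenceCost] at h
  have h1 : distortion ζ ζ' C / 2 ≤ ENNReal.ofReal δ :=
    (le_self_add.trans le_self_add).trans h.le
  have h2 : (⨆ p ∈ C, ENNReal.ofReal ‖ζ.eval p.1 - ζ'.eval p.2‖) ≤ ENNReal.ofReal δ :=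
    (le_add_self.trans le_self_add).trans h.le
  refine ⟨C, hC, fun p hp q hq => ?_, fun p hp => ?_⟩
  · have h3 : distortion ζ ζ' C ≤ ENNReal.ofReal (2 * δ) := by
      rw [ENNReal.div_le_iff two_ne_zero ENNReal.ofNat_ne_top] at h1
      refine h1.trans_eq ?_
      rw [mul_comm 2 δ, ENNReal.ofReal_mul hδ, ENNReal.ofReal_ofNat]
    rw [distortion] at h3
    exact (ENNReal.ofReal_le_ofReal_iff (by positivity)).1
      (iSup₂_le_iff.1 (iSup₂_le_iff.1 h3 p hp) q hq)
  · exact (ENNReal.ofReal_le_ofReal_iff hδ).1 (iSup₂_le_iff.1 h2 p hp)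

end SpatialTree

namespace CharTree

variable {α : ℝ} (ζ : CharTree α)

theorem exists_treeDist_lt_path_near {η : ℝ} (hη : 0 < η) : ∃ c : ℝ≥0∞, 0 < c ∧
    ∀ ζ' : CharTree α, SpatialTree.treeDist ζ.toSpatialTree ζ'.toSpatialTree < c →
      (∀ z, ∃ z', dist (ζ.path z) (ζ'.path z') ≤ η) ∧
      ∀ z', ∃ z, dist (ζ'.path z') (ζ.path z) ≤ η := by
  obtain ⟨R, hR, hRη⟩ := exists_five_div_one_add_le (show 0 < η / 4 by positivity)
  have h2R : 2 / (1 + R) = 2 / 5 * (5 / (1 + R)) := by ring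
  have h2R0 : 0 ≤ 5 / (1 + R) := by positivity
  obtain ⟨r, hr⟩ := ζ.exists_radius_forall_path_near hR
  -- The radius covers the relevant starting points in both trees; the last entry anticipates
  -- `b_{ζ'}(R) ≤ b_ζ(R + 1) + 1`.
  let ρ := max (max r (ζ.properness R + 2 * R)) (ζ.properness (R + 1) + 1 + 2 * R)
  have hρ1 : r ≤ ρ := (le_max_left _ _).trans (le_max_left _ _)
  have hρ2 : ζ.properness R + 2 * R ≤ ρ := (le_max_right _ _).trans (le_max_left _ _)
  have hρ3 : ζ.properness (R + 1) + 1 + 2 * R ≤ ρ := le_max_right _ _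
  have hρ0 : 0 ≤ ρ := (by linarith [ζ.properness_nonneg R] : 0 ≤ ζ.properness R + 2 * R).trans hρ2
  -- Partners of points of the `ρ`-balls lie in the `(ρ + 2)`-balls, as `2δ ≤ 2`, and base times
  -- differ by at most `δ ≤ 1`. Rays from there, followed down to time `-R`, stay in the `a`-balls.
  let a := 2 * (ρ + 2) + (|ζ.time ζ.base| + 1) + R
  have ha : 0 ≤ a := by positivity
  obtain ⟨δ, hδ, hδ1, hδε, hmod⟩ := ζ.exists_space_modulus (a + 1) (ε := η / 8) (by positivity)
  refine ⟨min (ENNReal.ofReal (Real.exp (-(a + 1))) * ENNReal.ofReal δ)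
    (ENNReal.ofReal (Real.exp (-(R + 1)))), lt_min ?_ ?_, fun ζ' hd => ?_⟩
  · exact ENNReal.mul_pos (ENNReal.ofReal_pos.2 (Real.exp_pos _)).ne' (ENNReal.ofReal_pos.2 hδ).ne'
  · exact ENNReal.ofReal_pos.2 (Real.exp_pos _)
  rw [SpatialTree.treeDist, lt_min_iff] at hd
  have hprop : ζ'.properness R ≤ ζ.properness (R + 1) + 1 :=
    le_of_m1Dist_lt ζ.monotone_properness hR (le_add_self.trans_lt hd.2)
  obtain ⟨t, ht, hball⟩ := exists_lt_of_lintegral_exp_lt ha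
    (by rw [← ENNReal.ofReal_one]; exact ENNReal.ofReal_le_ofReal hδ1) (le_self_add.trans_lt hd.1)
  obtain ⟨C, hC, hdist, heval⟩ := SpatialTree.exists_correspondence_of_ballDist_lt hδ.le hball
  obtain ⟨hCball, hCfst, hCsnd, hCbase⟩ := hC
  have hcoord : ∀ i, ∀ p ∈ C, |ζ.eval p.1 i - ζ'.eval p.2 i| ≤ δ := fun i p hp =>
    (PiLp.norm_apply_le (ζ.eval p.1 - ζ'.eval p.2) i).trans (heval p hp)
  have htb : |ζ'.time ζ'.base| ≤ |ζ.time ζ.base| + 1 := by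
    have h1 := hcoord 0 _ hCbase
    have h2 := abs_sub_abs_le_abs_sub (ζ'.time ζ'.base) (ζ.time ζ.base)
    rw [abs_sub_comm] at h2
    change |ζ.time ζ.base - ζ'.time ζ'.base| ≤ δ at h1
    linarith
  have hpair : ∀ z z', (z, z') ∈ C → dist ζ.base z ≤ ρ + 2 → dist ζ'.base z' ≤ ρ + 2 →
      dist (ζ.path z) (ζ'.path z') ≤ η / 2 := by
    intro z z' hzz hz hz'
    have key := ζ.dist_path_le_of_relation ζ' (C := C) (R := R) (δ := δ) (ε := η / 8) hR
      (by positivity) hdist (hcoord 0) (fun p hp => (hcoord 1 p hp).trans hδε)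
      (fun p hp q hq h => hmod _ _
        (by rw [dist_comm]; exact (hCball p hp).1.trans ht.2)
        (by rw [dist_comm]; exact (hCball q hq).1.trans ht.2) h) hzz
      (fun s hs => hCfst _ (by
        rw [Metric.mem_closedBall, dist_comm]
        have := ζ.dist_base_below_le hR hz hs
        linarith [ht.1]))
      (fun s hs => hCsnd _ (by
        rw [Metric.mem_closedBall, dist_comm]
        have := ζ'.dist_base_below_le hR hz' hs
        linarith [ht.1]))
    linarith
  have hat : ρ ≤ t := by
    have : ρ ≤ a := by
      change ρ ≤ 2 * (ρ + 2) + (|ζ.time ζ.base| + 1) + R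
      linarith [abs_nonneg (ζ.time ζ.base)]
    linarith [ht.1]
  have hfwd : ∀ w, dist ζ.base w ≤ ρ → ∃ w', dist (ζ.path w) (ζ'.path w') ≤ η / 2 := by
    intro w hw
    obtain ⟨w', hw'⟩ := hCfst w (by rw [Metric.mem_closedBall, dist_comm]; exact hw.trans hat)
    have := abs_le.1 (hdist _ hCbase _ hw')
    simp only at this
    exact ⟨w', hpair w w' hw' (by linarith) (by linarith)⟩
  have hbwd : ∀ w', dist ζ'.base w' ≤ ρ → ∃ w, dist (ζ.path w) (ζ'.path w') ≤ η / 2 := by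
    intro w' hw'
    obtain ⟨w, hw⟩ := hCsnd w' (by rw [Metric.mem_closedBall, dist_comm]; exact hw'.trans hat)
    have := abs_le.1 (hdist _ hCbase _ hw)
    simp only at this
    exact ⟨w, hpair w w' hw (by linarith) (by linarith)⟩
  constructor
  · intro z
    have hnear : ∃ w, dist ζ.base w ≤ ρ ∧ dist (ζ.path z) (ζ.path w) ≤ η / 4 := by
      rcases hr ζ z with ⟨w, hw, hd⟩ | ⟨w, hw, hd⟩
      · exact ⟨w, hw.trans hρ1, hd.trans hRη⟩
      · exact ⟨w, hw.trans hρ2, by linarith⟩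
    obtain ⟨w, hw, hd⟩ := hnear
    obtain ⟨w', hw'⟩ := hfwd w hw
    exact ⟨w', by linarith [dist_triangle (ζ.path z) (ζ.path w) (ζ'.path w')]⟩
  · intro z'
    rcases hr ζ' z' with ⟨w, -, hd⟩ | ⟨w', hw', hd⟩
    · exact ⟨w, by linarith⟩
    · obtain ⟨w, hw⟩ := hbwd w' (by linarith)
      rw [dist_comm] at hw
      exact ⟨w, by linarith [dist_triangle (ζ'.path z') (ζ'.path w') (ζ.path w)]⟩

end CharTree

/-! ### The map `K` -/

theorem isCompact_radialPathSet {α : ℝ} (ζ : CharSpace α) : IsCompact (radialPathSet ζ) :=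
  Quotient.inductionOn ζ fun ζ => ζ.isCompact_closure_pathSet

theorem nonempty_radialPathSet {α : ℝ} (ζ : CharSpace α) : (radialPathSet ζ).Nonempty :=
  Quotient.inductionOn ζ fun ζ =>
    ⟨ζ.path ζ.base, subset_closure (ζ.pathSet_eq_range ▸ mem_range_self _)⟩

/-- The map `K`, with values in the nonempty compact sets of paths. -/
def radialPathCompacts {α : ℝ} (ζ : CharSpace α) : TopologicalSpace.NonemptyCompacts BackwardPath where
  carrier := radialPathSet ζ
  isCompact' := isCompact_radialPathSet ζ
  nonempty' := nonempty_radialPathSet ζ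

theorem continuous_radialPathCompacts {α : ℝ} :
    Continuous (radialPathCompacts : CharSpace α → TopologicalSpace.NonemptyCompacts BackwardPath) := by
  refine (isQuotientMap_quotient_mk' (s := CharTree.instSetoid α)).continuous_iff.2 ?_
  -- Open sets of representatives are defined by `treeDist`-balls, so a single threshold around each
  -- `ζ` suffices.
  refine continuous_def.2 fun U hU ζ hζ => ?_
  obtain ⟨η, hη, hball⟩ := Metric.isOpen_iff.1 hU _ hζ
  obtain ⟨c, hc, h⟩ := ζ.exists_treeDist_lt_path_near (half_pos hη)
  refine ⟨c, hc, fun ζ' hd => hball ?_⟩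
  obtain ⟨h1, h2⟩ := h ζ' hd
  rw [Metric.mem_ball, Metric.NonemptyCompacts.dist_eq]
  change Metric.hausdorffDist (closure ζ'.pathSet) (closure ζ.pathSet) < η
  rw [Metric.hausdorffDist_closure, ζ.pathSet_eq_range, ζ'.pathSet_eq_range]
  refine lt_of_le_of_lt (Metric.hausdorffDist_le_of_mem_dist (half_pos hη).le ?_ ?_) (half_lt_self hη)
  · rintro _ ⟨z', rfl⟩
    obtain ⟨z, hz⟩ := h2 z'
    exact ⟨_, mem_range_self z, hz⟩
  · rintro _ ⟨z, rfl⟩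
    obtain ⟨z', hz⟩ := h1 z
    exact ⟨_, mem_range_self z', hz⟩

/-- `K(ζ)` is a (nonempty) compact set of paths, and `K` is continuous for the Hausdorff metric;
equivalently, the topology of `Δ_sp` is finer than the one induced through `K`. -/
theorem propositionp (α : ℝ) (hα₀ : 0 < α) (hα₁ : α < 1) :
    (∀ ζ : CharSpace α, IsCompact (radialPathSet ζ)) ∧
    ∃ K : CharSpace α → TopologicalSpace.NonemptyCompacts BackwardPath,
      (∀ ζ, (K ζ : Set BackwardPath) = radialPathSet ζ) ∧
      Continuous K ∧
      (inferInstance : TopologicalSpace (CharSpace α)) ≤ TopologicalSpace.induced K inferInstance :=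
  ⟨isCompact_radialPathSet, radialPathCompacts, fun _ => rfl, continuous_radialPathCompacts,
    continuous_iff_le_induced.1 continuous_radialPathCompacts⟩
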